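/- Consider the stationary incompressible Navier–Stokes equations in $\mathbb R^3$ with viscosity $\nu>0$, $$-\nu\Delta u+u\cdot\nabla u+\nabla p=0,\qquad \operatorname{div}u=0. \tag{NS}$$ Let $(r,\theta,\phi)$ be spherical coordinates ($\theta$ the angle to the positive $x_3$-axis), with unit vectors $e_r,e_\theta,e_\phi$, write $u=u_re_r+u_\theta e_\theta+u_\phi e_\phi$, and let $N,S$ be the north and south poles of the unit sphere $\mathbb S^2$. A *$(-1)$-homogeneous axisymmetric no-swirl solution of (NS) which is smooth on $\mathbb S^2\setminus\{S,N\}$* is a pair $(u,p)$, smooth on $\mathbb R^3$ minus the $x_3$-axis and satisfying (NS) there, such that $u$ is homogeneous of degree $-1$, $p$ is homogeneous of degree $-2$, $u_r,u_\theta,u_\phi$ do not depend on $\phi$, and $u_\phi=0$. (i) For any $0<\theta_1<\theta_2<\theta_3<\theta_4<\pi$ there is a constant $C>0$, depending only on the $\theta_i$, such that for every $0<\nu<1$ and every $(-1)$-homogeneous axisymmetric no-swirl solution $(u_\nu,p_\nu)$ of (NS) which is smooth on $\mathbb S^2\setminus\{S,N\}$, $$\int_{\mathbb S^2\cap\{\theta_1<\theta<\theta_4\}}|u_{\nu,\theta}|^2\le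 C\left(\int_{\mathbb S^2\cap\{\theta_2<\theta<\theta_3\}}|u_{\nu,\theta}|^2+\nu^2\right).$$ (ii) Let $\nu_k>0$, $\nu_k\to0$, and let $(u_{\nu_k},p_{\nu_k})$ be $(-1)$-homogeneous axisymmetric no-swirl solutions of (NS) with $\nu=\nu_k$ which are smooth on $\mathbb S^2\setminus\{S,N\}$. If $$\sup_k\ \nu_k^{-2}\int_{\mathbb S^2\cap\{a<\theta<b\}}|u_{\nu_k,\theta}|^2<\infty\quad\text{for some }0<a<b<\pi,$$ then there is a $(-1)$-homogeneous axisymmetric no-swirl solution $(\tilde u,\tilde p)$ of (NS) with $\nu=1$ which is smooth on $\mathbb S^2\setminus\{S,N\}$ such that, after passing to a subsequence, for every $\epsilon>0$ and every integer $m\ge0$, $$\lim_{k\to\infty}\left\|\left(\frac{u_{\nu_k}}{\nu_k},\frac{p_{\nu_k}}{\nu_k^2}\right)-(\tilde u,\tilde p)\right\|_{C^m(\mathbb S^2\cap\{\epsilon<\theta<\pi-\epsilon\})}=0.$$ -/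

import Mathlib

open Real Set Filter Topology MeasureTheory
open scoped ENNReal ContDiff InnerProductSpace Gradient

noncomputable section

namespace HomNS

/-- Euclidean three-space. -/
abbrev E3 : Type := EuclideanSpace ℝ (Fin 3)

/-- `ℝ³` minus the `x₃`-axis: the open cone generated by the unit sphere minus its two poles. -/
def offAxis : Set E3 := {x | x 0 ≠ 0 ∨ x 1 ≠ 0}

/-- The radial unit vector at polar angle `θ` and meridian angle `φ`;
`r • eR θ φ` is the point with spherical coordinates `(r, θ, φ)`. -/
def eR (θ φ : ℝ) : E3 := !₂[sin θ * cos φ, sin θ * sin φ, cos θ]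

/-- The unit vector in the direction of increasing polar angle. -/
def eTheta (θ φ : ℝ) : E3 := !₂[cos θ * cos φ, cos θ * sin φ, -sin θ]

/-- The unit vector in the direction of increasing meridian angle. -/
def ePhi (φ : ℝ) : E3 := !₂[-sin φ, cos φ, 0]

/-- The component `u_r` at the point with spherical coordinates `(r, θ, φ)`. -/
def compR (u : E3 → E3) (r θ φ : ℝ) : ℝ := ⟪u (r • eR θ φ), eR θ φ⟫_ℝ

/-- The component `u_θ` at the point with spherical coordinates `(r, θ, φ)`. -/
def compTheta (u : E3 → E3) (r θ φ : ℝ) : ℝ := ⟪u (r • eR θ φ), eTheta θ φ⟫_ℝ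

/-- The component `u_φ` at the point with spherical coordinates `(r, θ, φ)`. -/
def compPhi (u : E3 → E3) (r θ φ : ℝ) : ℝ := ⟪u (r • eR θ φ), ePhi φ⟫_ℝ

/-- Axisymmetric: away from the axis, the three spherical components depend only on `r`
and `θ`. -/
def Axisymmetric (u : E3 → E3) : Prop :=
  ∀ r > 0, ∀ θ ∈ Ioo 0 π, ∀ φ φ' : ℝ,
    compR u r θ φ = compR u r θ φ' ∧
    compTheta u r θ φ = compTheta u r θ φ' ∧
    compPhi u r θ φ = compPhi u r θ φ'

/-- No swirl: `u_φ = 0` away from the axis. -/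
def NoSwirl (u : E3 → E3) : Prop :=
  ∀ r > 0, ∀ θ ∈ Ioo 0 π, ∀ φ : ℝ, compPhi u r θ φ = 0

/-- The divergence of a vector field on `ℝ³`. -/
def divergence (u : E3 → E3) (x : E3) : ℝ :=
  ∑ i : Fin 3, fderiv ℝ u x (EuclideanSpace.single i 1) i

/-- `(u, p)` is a `(-1)`-homogeneous axisymmetric no-swirl solution of the stationary
incompressible Navier-Stokes equations with viscosity `ν` which is smooth on the unit sphere
minus the poles (equivalently, by homogeneity, on `ℝ³` minus the `x₃`-axis). Here `u` is
homogeneous of degree `-1` and `p` is homogeneous of degree `-2`. -/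
structure IsSolution (ν : ℝ) (u : E3 → E3) (p : E3 → ℝ) : Prop where
  smooth_u : ContDiffOn ℝ ∞ u offAxis
  smooth_p : ContDiffOn ℝ ∞ p offAxis
  homogeneous_u : ∀ x ∈ offAxis, ∀ t : ℝ, 0 < t → u (t • x) = t⁻¹ • u x
  homogeneous_p : ∀ x ∈ offAxis, ∀ t : ℝ, 0 < t → p (t • x) = (t ^ 2)⁻¹ * p x
  axisymmetric : Axisymmetric u
  noSwirl : NoSwirl u
  momentum : ∀ x ∈ offAxis,
    -(ν • Laplacian.laplacian u x) + fderiv ℝ u x (u x) + gradient p x = 0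
  incompressible : ∀ x ∈ offAxis, divergence u x = 0

/-- `∫ |u_θ|²` over the band `{a < θ < b}` of the unit sphere with respect to surface measure
`sin θ dφ dθ` (for `0 ≤ a ≤ b ≤ π`). -/
def bandEnergy (u : E3 → E3) (a b : ℝ) : ℝ :=
  ∫ θ in a..b, ∫ φ in (0 : ℝ)..(2 * π), |compTheta u 1 θ φ| ^ 2 * sin θ

/-- The band `{a < θ < b}` of the unit sphere, `θ` being the angle to the positive
`x₃`-axis. -/
def sphereBand (a b : ℝ) : Set E3 := {x | ‖x‖ = 1 ∧ arccos (x 2) ∈ Ioo a b}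

/-- The extension of the restriction of `f` to the unit sphere which is constant along rays. -/
def radialExtension {F : Type*} (f : E3 → F) (x : E3) : F := f (‖x‖⁻¹ • x)

/-- The `C^m` norm, on a subset `s` of the unit sphere (open in the sphere), of the restriction
of `f` to the sphere: the largest supremum over `s` of the norms of the derivatives of order at
most `m`, the function being extended to be constant along rays. -/
def sphereCmNorm {F : Type*} [NormedAddCommGroup F] [NormedSpace ℝ F]
    (m : ℕ) (s : Set E3) (f : E3 → F) : ℝ≥0∞ :=
  ⨆ j : ℕ, ⨆ _ : j ≤ m, ⨆ x ∈ s, ‖iteratedFDeriv ℝ j (radialExtension f) x‖ₑ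

end HomNS

end

/-! Replacing `(u, p)` by `(u / ν, p / ν²)` reduces everything to viscosity one
(`IsSolution.rescale`). There the solution is described by profiles on `(0, π)`, with `u = r⁻¹ (w
e_r + v e_θ)` and `p = r⁻² P`, and the equations become an ODE system for `w`, `v`, `P`. This system
has three first integrals. After they are used, what remains is the scalar Riccati equation `v' =
cot θ · v + v² / 2 - q(cos θ) / sin² θ`, where `q` is a polynomial of degree at most two with
coefficients `c`; `w` and `P` are explicit in `c` and `v` (`exists_riccati_of_equations`, with
converse `equations_of_riccati`).

Part (i) follows from two tests of this equation. Testing with a weight times `sin² θ · q(cos θ)`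
produces a positive definite quadratic form in `c`, so the `L²` norm of `v` on any band controls `c`
(`exists_coefficient_bound`). Testing with a squared cutoff uses the favourable sign of `v² / 2`, so
`c` controls the `L²` norm of `v` on every compact subinterval (`exists_energy_bound`). Chaining the
two carries energy from a small band to a larger one.

For part (ii), the hypothesis bounds the coefficients of the rescaled solutions. The energy bound
then gives local pointwise bounds (`exists_pointwise_bound`). A subsequence along which `c` and `v(π
/ 2)` converge is locally uniformly Cauchy by Gronwall, and its limit again solves the Riccati
equation (`exists_subseq_riccati`). The equation upgrades this to convergence of all derivatives
(`locallyNullUpTo_sub`), and the chain and product rules transfer it to the sphere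
(`tendsto_sphereCmNorm_of_profiles`). -/

noncomputable section

namespace HomNS

/-! ### The spherical frame -/

/-- The horizontal unit vector pointing away from the axis. -/
def eRho (φ : ℝ) : E3 := !₂[cos φ, sin φ, 0]

/-- The vertical unit vector. -/
def eZ : E3 := !₂[0, 0, 1]

lemma eR_eq (θ φ : ℝ) : eR θ φ = sin θ • eRho φ + cos θ • eZ := by
  ext i; fin_cases i <;> simp [eR, eRho, eZ]

lemma eTheta_eq (θ φ : ℝ) : eTheta θ φ = cos θ • eRho φ - sin θ • eZ := by
  ext i; fin_cases i <;> simp [eTheta, eRho, eZ]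

lemma eRho_eq (θ φ : ℝ) : eRho φ = sin θ • eR θ φ + cos θ • eTheta θ φ := by
  rw [eR_eq, eTheta_eq]
  have h := sin_sq_add_cos_sq θ
  have h2 : sin θ • (sin θ • eRho φ + cos θ • eZ) + cos θ • (cos θ • eRho φ - sin θ • eZ)
      = (sin θ ^ 2 + cos θ ^ 2) • eRho φ := by module
  rw [h2, h, one_smul]

lemma hasDerivAt_eRho (φ : ℝ) : HasDerivAt eRho (ePhi φ) φ := by
  have h : eRho = fun t => cos t • (!₂[1, 0, 0] : E3) + sin t • (!₂[0, 1, 0] : E3) := by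
    funext t; ext i; fin_cases i <;> simp [eRho]
  rw [h]
  refine (((hasDerivAt_cos φ).smul_const (!₂[1, 0, 0] : E3)).add
    ((hasDerivAt_sin φ).smul_const (!₂[0, 1, 0] : E3))).congr_deriv ?_
  ext i; fin_cases i <;> simp [ePhi]

lemma hasDerivAt_ePhi (φ : ℝ) : HasDerivAt ePhi (-eRho φ) φ := by
  have h : ePhi = fun t => (-sin t) • (!₂[1, 0, 0] : E3) + cos t • (!₂[0, 1, 0] : E3) := by
    funext t; ext i; fin_cases i <;> simp [ePhi]
  rw [h]
  refine (((hasDerivAt_sin φ).neg.smul_const (!₂[1, 0, 0] : E3)).add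
    ((hasDerivAt_cos φ).smul_const (!₂[0, 1, 0] : E3))).congr_deriv ?_
  ext i; fin_cases i <;> simp [eRho]

lemma hasDerivAt_eR (θ φ : ℝ) : HasDerivAt (fun t => eR t φ) (eTheta θ φ) θ := by
  simp only [eR_eq]
  refine (((hasDerivAt_sin θ).smul_const (eRho φ)).add
    ((hasDerivAt_cos θ).smul_const eZ)).congr_deriv ?_
  rw [eTheta_eq]; module

lemma hasDerivAt_eTheta (θ φ : ℝ) : HasDerivAt (fun t => eTheta t φ) (-eR θ φ) θ := by
  simp only [eTheta_eq]
  refine (((hasDerivAt_cos θ).smul_const (eRho φ)).sub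
    ((hasDerivAt_sin θ).smul_const eZ)).congr_deriv ?_
  rw [eR_eq]; module

lemma inner_E3 (x y : E3) : ⟪x, y⟫_ℝ = x 0 * y 0 + x 1 * y 1 + x 2 * y 2 := by
  simp [PiLp.inner_apply, Fin.sum_univ_three]; ring

lemma inner_eR_eR (θ φ : ℝ) : ⟪eR θ φ, eR θ φ⟫_ℝ = 1 := by
  simp only [inner_E3, eR]; simp
  linear_combination sin θ ^ 2 * sin_sq_add_cos_sq φ + sin_sq_add_cos_sq θ

lemma inner_eTheta_eTheta (θ φ : ℝ) : ⟪eTheta θ φ, eTheta θ φ⟫_ℝ = 1 := by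
  simp only [inner_E3, eTheta]; simp
  linear_combination cos θ ^ 2 * sin_sq_add_cos_sq φ + sin_sq_add_cos_sq θ

lemma inner_ePhi_ePhi (φ : ℝ) : ⟪ePhi φ, ePhi φ⟫_ℝ = 1 := by
  simp only [inner_E3, ePhi]; simp
  linear_combination sin_sq_add_cos_sq φ

lemma inner_eR_eTheta (θ φ : ℝ) : ⟪eR θ φ, eTheta θ φ⟫_ℝ = 0 := by
  simp only [inner_E3, eR, eTheta]; simp
  linear_combination sin θ * cos θ * sin_sq_add_cos_sq φ

lemma inner_eR_ePhi (θ φ : ℝ) : ⟪eR θ φ, ePhi φ⟫_ℝ = 0 := by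
  simp only [inner_E3, eR, ePhi]; simp; ring

lemma inner_eTheta_ePhi (θ φ : ℝ) : ⟪eTheta θ φ, ePhi φ⟫_ℝ = 0 := by
  simp only [inner_E3, eTheta, ePhi]; simp; ring

lemma inner_eTheta_eR (θ φ : ℝ) : ⟪eTheta θ φ, eR θ φ⟫_ℝ = 0 := by
  rw [real_inner_comm, inner_eR_eTheta]

lemma inner_ePhi_eR (θ φ : ℝ) : ⟪ePhi φ, eR θ φ⟫_ℝ = 0 := by
  rw [real_inner_comm, inner_eR_ePhi]

lemma inner_ePhi_eTheta (θ φ : ℝ) : ⟪ePhi φ, eTheta θ φ⟫_ℝ = 0 := by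
  rw [real_inner_comm, inner_eTheta_ePhi]

lemma norm_eR (θ φ : ℝ) : ‖eR θ φ‖ = 1 := by
  have h := inner_eR_eR θ φ
  rw [real_inner_self_eq_norm_sq] at h
  nlinarith [norm_nonneg (eR θ φ)]

lemma frame_orthonormal (θ φ : ℝ) : Orthonormal ℝ ![eR θ φ, eTheta θ φ, ePhi φ] := by
  rw [orthonormal_iff_ite]
  intro i j
  fin_cases i <;> fin_cases j <;>
    simp only [Fin.zero_eta, Fin.mk_one, Fin.reduceFinMk, Fin.isValue, Matrix.cons_val,
      inner_eR_eR, inner_eTheta_eTheta, inner_ePhi_ePhi, inner_eR_eTheta, inner_eR_ePhi,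
      inner_eTheta_ePhi, inner_eTheta_eR, inner_ePhi_eR, inner_ePhi_eTheta] <;> simp

/-- The orthonormal basis `(e_r, e_θ, e_φ)`. -/
def frame (θ φ : ℝ) : OrthonormalBasis (Fin 3) ℝ E3 :=
  OrthonormalBasis.mk (frame_orthonormal θ φ)
    ((frame_orthonormal θ φ).linearIndependent.span_eq_top_of_card_eq_finrank' (by simp)).ge

lemma frame_zero (θ φ : ℝ) : frame θ φ 0 = eR θ φ := by simp [frame]
lemma frame_one (θ φ : ℝ) : frame θ φ 1 = eTheta θ φ := by simp [frame]
lemma frame_two (θ φ : ℝ) : frame θ φ 2 = ePhi φ := by simp [frame]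

lemma frame_expansion (θ φ : ℝ) (y : E3) :
    y = ⟪y, eR θ φ⟫_ℝ • eR θ φ + ⟪y, eTheta θ φ⟫_ℝ • eTheta θ φ + ⟪y, ePhi φ⟫_ℝ • ePhi φ := by
  have h := (frame θ φ).sum_repr' y
  rw [Fin.sum_univ_three, frame_zero, frame_one, frame_two] at h
  rw [real_inner_comm, real_inner_comm (eTheta θ φ), real_inner_comm (ePhi φ)]
  exact h.symm

/-! ### Spherical coordinates off the axis -/

lemma isOpen_offAxis : IsOpen offAxis := by
  have h0 : Continuous fun x : E3 => x 0 := by fun_prop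
  have h1 : Continuous fun x : E3 => x 1 := by fun_prop
  exact (isOpen_ne_fun h0 continuous_const).union (isOpen_ne_fun h1 continuous_const)

lemma smul_eR_mem_offAxis {r θ : ℝ} (hr : 0 < r) (hθ : θ ∈ Ioo 0 π) (φ : ℝ) :
    r • eR θ φ ∈ offAxis := by
  have hs := (sin_pos_of_pos_of_lt_pi hθ.1 hθ.2).ne'
  by_contra hcon
  simp only [offAxis, mem_ofPred_eq, not_or, not_not] at hcon
  obtain ⟨h0, h1⟩ := hcon
  simp [eR, hr.ne', hs] at h0 h1
  have := sin_sq_add_cos_sq φ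
  rw [h0, h1] at this; norm_num at this

lemma norm_sq_E3 (x : E3) : ‖x‖ ^ 2 = x 0 ^ 2 + x 1 ^ 2 + x 2 ^ 2 := by
  rw [EuclideanSpace.norm_sq_eq, Fin.sum_univ_three]; simp

lemma norm_pos_of_mem_offAxis {x : E3} (hx : x ∈ offAxis) : 0 < ‖x‖ := by
  rw [norm_pos_iff]; rintro rfl; simp [offAxis] at hx

lemma radial_sq_pos {x : E3} (hx : x ∈ offAxis) : 0 < x 0 ^ 2 + x 1 ^ 2 := by
  rcases hx with h | h
  · have := sq_nonneg (x 1); positivity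
  · have := sq_nonneg (x 0); positivity

/-- The polar angle of a point. -/
def polar (x : E3) : ℝ := arccos (x 2 / ‖x‖)

/-- The field `e_θ` in Cartesian coordinates. -/
def fieldTheta (x : E3) : E3 :=
  (‖x‖ * √(x 0 ^ 2 + x 1 ^ 2))⁻¹ • !₂[x 2 * x 0, x 2 * x 1, -(x 0 ^ 2 + x 1 ^ 2)]

lemma exists_spherical {x : E3} (hx : x ∈ offAxis) :
    ∃ θ ∈ Ioo 0 π, ∃ φ : ℝ, x = ‖x‖ • eR θ φ := by
  have hn := norm_pos_of_mem_offAxis hx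
  have hρ := radial_sq_pos hx
  have hsq := norm_sq_E3 x
  set ρ := √(x 0 ^ 2 + x 1 ^ 2) with hρdef
  have hρpos : 0 < ρ := sqrt_pos.2 hρ
  have hρsq : ρ ^ 2 = x 0 ^ 2 + x 1 ^ 2 := sq_sqrt hρ.le
  have habs : |x 2| < ‖x‖ := by
    apply abs_lt_of_sq_lt_sq _ hn.le
    rw [hsq]; linarith
  have hlt := abs_lt.1 habs
  have h1 : -1 < x 2 / ‖x‖ := by rw [lt_div_iff₀ hn]; linarith
  have h2 : x 2 / ‖x‖ < 1 := by rw [div_lt_iff₀ hn]; linarith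
  have hsin : sin (polar x) = ρ / ‖x‖ := by
    rw [polar, sin_arccos, sqrt_eq_iff_mul_self_eq (by nlinarith) (by positivity)]
    field_simp
    rw [hρsq, hsq]; ring
  have hcos : cos (polar x) = x 2 / ‖x‖ := cos_arccos h1.le h2.le
  -- The azimuth is the argument of `x₀ + i x₁`, which is nonzero off the axis.
  let z : ℂ := ⟨x 0, x 1⟩
  have hz : ‖z‖ = ρ := by
    rw [Complex.norm_def, Complex.normSq_mk, hρdef]; congr 1; ring
  have hz0 : z ≠ 0 := by rw [← norm_pos_iff, hz]; exact hρpos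
  refine ⟨polar x, ⟨arccos_pos.2 h2, ?_⟩, z.arg, ?_⟩
  · rw [polar, ← arccos_neg_one]
    exact strictAntiOn_arccos ⟨le_rfl, by norm_num⟩ ⟨h1.le, h2.le⟩ h1
  · have hc : cos z.arg = x 0 / ρ := by rw [Complex.cos_arg hz0, hz]
    have hs : sin z.arg = x 1 / ρ := by rw [Complex.sin_arg, hz]
    ext i
    fin_cases i <;> simp [eR, hsin, hcos, hc, hs] <;> field_simp

lemma norm_smul_eR {r : ℝ} (hr : 0 < r) (θ φ : ℝ) : ‖r • eR θ φ‖ = r := by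
  rw [norm_smul, norm_eR, mul_one, Real.norm_of_nonneg hr.le]

lemma polar_smul_eR {r θ : ℝ} (hr : 0 < r) (hθ : θ ∈ Ioo 0 π) (φ : ℝ) :
    polar (r • eR θ φ) = θ := by
  rw [polar, norm_smul_eR hr]
  have : (r • eR θ φ) 2 / r = cos θ := by simp [eR]; field_simp
  rw [this, arccos_cos hθ.1.le hθ.2.le]

lemma fieldTheta_smul_eR {r θ : ℝ} (hr : 0 < r) (hθ : θ ∈ Ioo 0 π) (φ : ℝ) :
    fieldTheta (r • eR θ φ) = eTheta θ φ := by
  have hs := sin_pos_of_pos_of_lt_pi hθ.1 hθ.2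
  rw [fieldTheta, norm_smul_eR hr]
  have h1 : (r • eR θ φ) 0 ^ 2 + (r • eR θ φ) 1 ^ 2 = (r * sin θ) ^ 2 := by
    simp [eR]; linear_combination r ^ 2 * sin θ ^ 2 * sin_sq_add_cos_sq φ
  rw [h1, sqrt_sq (by positivity)]
  ext i
  fin_cases i <;> simp [eR, eTheta] <;> field_simp

lemma polar_mem {x : E3} (hx : x ∈ offAxis) : polar x ∈ Ioo 0 π := by
  obtain ⟨θ, hθ, φ, h⟩ := exists_spherical hx
  rw [h, polar_smul_eR (norm_pos_of_mem_offAxis hx) hθ]; exact hθ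

lemma contDiffOn_norm_offAxis : ContDiffOn ℝ ∞ (fun x : E3 => ‖x‖) offAxis := fun _ hx =>
  (contDiffAt_norm ℝ (norm_pos_iff.1 (norm_pos_of_mem_offAxis hx))).contDiffWithinAt

lemma contDiff_coord (i : Fin 3) : ContDiff ℝ ∞ (fun x : E3 => x i) := by fun_prop

lemma contDiffOn_polar : ContDiffOn ℝ ∞ polar offAxis := by
  intro x hx
  have hp := polar_mem hx
  have hx1 : x 2 / ‖x‖ ≠ -1 := by
    intro h; rw [polar, h, arccos_neg_one] at hp; exact lt_irrefl _ hp.2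
  have hx2 : x 2 / ‖x‖ ≠ 1 := by
    intro h; rw [polar, h, arccos_one] at hp; exact lt_irrefl _ hp.1
  have h : ContDiffAt ℝ ∞ (fun x : E3 => x 2 / ‖x‖) x :=
    (contDiff_coord 2).contDiffAt.div
      (contDiffAt_norm ℝ (norm_pos_iff.1 (norm_pos_of_mem_offAxis hx)))
      (norm_pos_of_mem_offAxis hx).ne'
  exact (ContDiffAt.comp x (contDiffAt_arccos hx1 hx2) h).contDiffWithinAt

lemma contDiffOn_fieldTheta : ContDiffOn ℝ ∞ fieldTheta offAxis := by
  intro x hx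
  have hn := norm_pos_of_mem_offAxis hx
  have hρ := radial_sq_pos hx
  have h0 := (contDiff_coord 0).contDiffAt (x := x)
  have h1 := (contDiff_coord 1).contDiffAt (x := x)
  have h2 := (contDiff_coord 2).contDiffAt (x := x)
  have hr : ContDiffAt ℝ ∞ (fun x : E3 => x 0 ^ 2 + x 1 ^ 2) x := (h0.pow 2).add (h1.pow 2)
  have hv : ContDiffAt ℝ ∞ (fun x : E3 =>
      (!₂[x 2 * x 0, x 2 * x 1, -(x 0 ^ 2 + x 1 ^ 2)] : E3)) x := by
    rw [contDiffAt_euclidean]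
    intro i
    fin_cases i
    · exact h2.mul h0
    · exact h2.mul h1
    · exact hr.neg
  have hd : ContDiffAt ℝ ∞ (fun x : E3 => ‖x‖ * √(x 0 ^ 2 + x 1 ^ 2)) x :=
    (contDiffAt_norm ℝ (norm_pos_iff.1 hn)).mul (hr.sqrt hρ.ne')
  have hd0 : ‖x‖ * √(x 0 ^ 2 + x 1 ^ 2) ≠ 0 := by have := sqrt_pos.2 hρ; positivity
  exact ((hd.inv hd0).smul hv).contDiffWithinAt

/-! ### Differential operators on homogeneous axisymmetric fields without swirl -/

/-! ### Directional derivatives read off along curves -/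

section Curves

variable {F : Type*} [NormedAddCommGroup F] [NormedSpace ℝ F]

/-- Chain rule. It is applied to rays, meridians and circles of latitude, whose tangents are
multiples of `e_r`, `e_θ`, `e_φ`. -/
lemma fderiv_along_curve {u : E3 → F} {γ : ℝ → E3} {γ' : E3} {g : ℝ → F} {g' : F} {t : ℝ}
    (hu : ContDiffOn ℝ ∞ u offAxis) (hmem : γ t ∈ offAxis) (hγ : HasDerivAt γ γ' t)
    (hug : ∀ᶠ s in 𝓝 t, u (γ s) = g s) (hg : HasDerivAt g g' t) :
    fderiv ℝ u (γ t) γ' = g' := by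
  have hd : DifferentiableAt ℝ u (γ t) :=
    (hu.contDiffAt (isOpen_offAxis.mem_nhds hmem)).differentiableAt (by simp)
  exact (hd.hasFDerivAt.comp_hasDerivAt t hγ).unique (hg.congr_of_eventuallyEq hug)

/-- Differentiating `Du(γ) γ'` once more leaves, besides the Hessian, the term `Du(γ) γ''` due to
the curvature of the curve. It is a first derivative already known: `γ''` is zero on rays, `-r e_r`
on meridians and `-r sin θ e_ρ` on circles of latitude. -/
lemma fderiv_fderiv_along_curve {u : E3 → F} {γ γ₁ : ℝ → E3} {γ₂ : E3} {g g₁ : ℝ → F} {g₂ : F}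
    {t : ℝ} (hu : ContDiffOn ℝ ∞ u offAxis) (hmem : ∀ᶠ s in 𝓝 t, γ s ∈ offAxis)
    (hγ : ∀ s, HasDerivAt γ (γ₁ s) s) (hγ₁ : HasDerivAt γ₁ γ₂ t)
    (hug : ∀ᶠ s in 𝓝 t, u (γ s) = g s) (hg : ∀ᶠ s in 𝓝 t, HasDerivAt g (g₁ s) s)
    (hg₁ : HasDerivAt g₁ g₂ t) :
    fderiv ℝ (fderiv ℝ u) (γ t) (γ₁ t) (γ₁ t) + fderiv ℝ u (γ t) γ₂ = g₂ := by
  have hfirst : ∀ᶠ s in 𝓝 t, fderiv ℝ u (γ s) (γ₁ s) = g₁ s := by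
    filter_upwards [hmem, hug.eventually_nhds, hg] with s h1 h2 h3
    exact fderiv_along_curve hu h1 (hγ s) h2 h3
  have hd : DifferentiableAt ℝ (fderiv ℝ u) (γ t) := by
    have h := hu.contDiffAt (isOpen_offAxis.mem_nhds hmem.self_of_nhds)
    exact (h.fderiv_right (m := 1) (WithTop.coe_le_coe.2 le_top)).differentiableAt (by simp)
  have h2 : HasDerivAt (fun s => fderiv ℝ u (γ s) (γ₁ s))
      (fderiv ℝ (fderiv ℝ u) (γ t) (γ₁ t) (γ₁ t) + fderiv ℝ u (γ t) γ₂) t :=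
    (hd.hasFDerivAt.comp_hasDerivAt t (hγ t)).clm_apply hγ₁
  exact h2.unique (hg₁.congr_of_eventuallyEq hfirst)

end Curves

/-- `u` is smooth off the axis, homogeneous of degree `-1`, axisymmetric and without swirl, with
radial profile `w` and polar profile `v`. -/
structure HasProfile (u : E3 → E3) (w v : ℝ → ℝ) : Prop where
  smooth_u : ContDiffOn ℝ ∞ u offAxis
  smooth_w : ContDiffOn ℝ ∞ w (Ioo 0 π)
  smooth_v : ContDiffOn ℝ ∞ v (Ioo 0 π)
  u_eq : ∀ r > (0 : ℝ), ∀ θ ∈ Ioo 0 π, ∀ φ : ℝ,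
    u (r • eR θ φ) = r⁻¹ • (w θ • eR θ φ + v θ • eTheta θ φ)

/-- `p` is smooth off the axis, homogeneous of degree `-2` and axisymmetric, with profile `P`. -/
structure HasPressureProfile (p : E3 → ℝ) (P : ℝ → ℝ) : Prop where
  smooth_p : ContDiffOn ℝ ∞ p offAxis
  smooth_P : ContDiffOn ℝ ∞ P (Ioo 0 π)
  p_eq : ∀ r > (0 : ℝ), ∀ θ ∈ Ioo 0 π, ∀ φ : ℝ, p (r • eR θ φ) = (r ^ 2)⁻¹ * P θ

lemma hasDerivAt_of_smooth {f : ℝ → ℝ} {s : Set ℝ} (hs : IsOpen s) (hf : ContDiffOn ℝ ∞ f s)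
    {t : ℝ} (ht : t ∈ s) : HasDerivAt f (deriv f t) t :=
  ((hf.contDiffAt (hs.mem_nhds ht)).differentiableAt (by simp)).hasDerivAt

lemma contDiffOn_deriv {f : ℝ → ℝ} {s : Set ℝ} (hs : IsOpen s) (hf : ContDiffOn ℝ ∞ f s) :
    ContDiffOn ℝ ∞ (deriv f) s :=
  ((contDiffOn_infty_iff_deriv_of_isOpen hs).1 hf).2

/-! ### Divergence, Laplacian and convection in terms of the profiles -/

namespace HasProfile

variable {u : E3 → E3} {w v : ℝ → ℝ} (h : HasProfile u w v)
  {r θ : ℝ} (hr : 0 < r) (hθ : θ ∈ Ioo 0 π) (φ : ℝ)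

include h hr hθ

lemma fderiv_u_eR : fderiv ℝ u (r • eR θ φ) (eR θ φ)
    = (-(r ^ 2)⁻¹) • (w θ • eR θ φ + v θ • eTheta θ φ) := by
  refine fderiv_along_curve (γ := fun s => s • eR θ φ)
    (g := fun s => s⁻¹ • (w θ • eR θ φ + v θ • eTheta θ φ)) h.smooth_u
    (smul_eR_mem_offAxis hr hθ φ) ?_ ?_ ?_
  · simpa using (hasDerivAt_id r).smul_const (eR θ φ)
  · filter_upwards [lt_mem_nhds hr] with s hs using h.u_eq s hs θ hθ φ
  · exact (hasDerivAt_inv hr.ne').smul_const _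

lemma fderiv_fderiv_u_eR : fderiv ℝ (fderiv ℝ u) (r • eR θ φ) (eR θ φ) (eR θ φ)
    = (2 * (r ^ 3)⁻¹) • (w θ • eR θ φ + v θ • eTheta θ φ) := by
  have key := fderiv_fderiv_along_curve (t := r) (γ := fun s => s • eR θ φ)
    (γ₁ := fun _ => eR θ φ) (γ₂ := 0)
    (g := fun s => s⁻¹ • (w θ • eR θ φ + v θ • eTheta θ φ))
    (g₁ := fun s => (-(s ^ 2)⁻¹) • (w θ • eR θ φ + v θ • eTheta θ φ))
    (g₂ := (2 * (r ^ 3)⁻¹) • (w θ • eR θ φ + v θ • eTheta θ φ)) h.smooth_u ?_ ?_ ?_ ?_ ?_ ?_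
  · simpa using key
  · filter_upwards [lt_mem_nhds hr] with s hs using smul_eR_mem_offAxis hs hθ φ
  · intro s; simpa using (hasDerivAt_id s).smul_const (eR θ φ)
  · exact hasDerivAt_const _ _
  · filter_upwards [lt_mem_nhds hr] with s hs using h.u_eq s hs θ hθ φ
  · filter_upwards [lt_mem_nhds hr] with s hs
    exact (hasDerivAt_inv (ne_of_gt hs)).smul_const _
  · have h1 : HasDerivAt (fun s : ℝ => -(s ^ 2)⁻¹) (2 * (r ^ 3)⁻¹) r := by
      refine (((hasDerivAt_pow 2 r).inv (by positivity)).neg).congr_deriv ?_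
      field_simp; simp [mul_comm]
    exact h1.smul_const _

omit h hr hθ in
lemma hasDerivAt_meridian {a b : ℝ → ℝ} {a' b' t : ℝ} (ha : HasDerivAt a a' t)
    (hb : HasDerivAt b b' t) : HasDerivAt (fun s => r⁻¹ • (a s • eR s φ + b s • eTheta s φ))
      (r⁻¹ • ((a' - b t) • eR t φ + (b' + a t) • eTheta t φ)) t := by
  refine (((ha.smul (hasDerivAt_eR t φ)).add (hb.smul (hasDerivAt_eTheta t φ))).const_smul
    r⁻¹).congr_deriv ?_
  module

lemma fderiv_u_eTheta : fderiv ℝ u (r • eR θ φ) (eTheta θ φ)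
    = (r ^ 2)⁻¹ • ((deriv w θ - v θ) • eR θ φ + (deriv v θ + w θ) • eTheta θ φ) := by
  have key := fderiv_along_curve (t := θ) (γ := fun s => r • eR s φ)
    (γ' := r • eTheta θ φ) h.smooth_u
    (smul_eR_mem_offAxis hr hθ φ) ((hasDerivAt_eR θ φ).const_smul r)
    (g := fun s => r⁻¹ • (w s • eR s φ + v s • eTheta s φ)) ?_
    (hasDerivAt_meridian φ (hasDerivAt_of_smooth isOpen_Ioo h.smooth_w hθ)
      (hasDerivAt_of_smooth isOpen_Ioo h.smooth_v hθ))
  · rw [map_smul, ← eq_inv_smul_iff₀ hr.ne'] at key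
    rw [key, smul_smul]; congr 1; field_simp
  · filter_upwards [isOpen_Ioo.mem_nhds hθ] with s hs using h.u_eq r hr s hs φ

lemma fderiv_fderiv_u_eTheta :
    fderiv ℝ (fderiv ℝ u) (r • eR θ φ) (eTheta θ φ) (eTheta θ φ)
    = (r ^ 3)⁻¹ • ((deriv (deriv w) θ - 2 * deriv v θ - 2 * w θ) • eR θ φ
      + (deriv (deriv v) θ + 2 * deriv w θ - 2 * v θ) • eTheta θ φ) := by
  have hw := h.smooth_w
  have hv := h.smooth_v
  have hw1 := contDiffOn_deriv isOpen_Ioo hw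
  have hv1 := contDiffOn_deriv isOpen_Ioo hv
  have key := fderiv_fderiv_along_curve (t := θ) (γ := fun s => r • eR s φ)
    (γ₁ := fun s => r • eTheta s φ) (γ₂ := r • (-eR θ φ))
    (g := fun s => r⁻¹ • (w s • eR s φ + v s • eTheta s φ))
    (g₁ := fun s => r⁻¹ • ((deriv w s - v s) • eR s φ + (deriv v s + w s) • eTheta s φ))
    h.smooth_u ?_ (fun s => (hasDerivAt_eR s φ).const_smul r)
    ((hasDerivAt_eTheta θ φ).const_smul r) ?_ ?_
    (hasDerivAt_meridian φ
      ((hasDerivAt_of_smooth isOpen_Ioo hw1 hθ).sub (hasDerivAt_of_smooth isOpen_Ioo hv hθ))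
      ((hasDerivAt_of_smooth isOpen_Ioo hv1 hθ).add (hasDerivAt_of_smooth isOpen_Ioo hw hθ)))
  · simp only [map_smul, map_neg, _root_.smul_apply] at key
    rw [h.fderiv_u_eR hr hθ φ, ← eq_sub_iff_add_eq, ← eq_inv_smul_iff₀ hr.ne',
      ← eq_inv_smul_iff₀ hr.ne'] at key
    rw [key]
    match_scalars <;> field_simp <;> ring
  · filter_upwards [isOpen_Ioo.mem_nhds hθ] with s hs using smul_eR_mem_offAxis hr hs φ
  · filter_upwards [isOpen_Ioo.mem_nhds hθ] with s hs using h.u_eq r hr s hs φ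
  · filter_upwards [isOpen_Ioo.mem_nhds hθ] with s hs
    exact hasDerivAt_meridian φ (hasDerivAt_of_smooth isOpen_Ioo hw hs)
      (hasDerivAt_of_smooth isOpen_Ioo hv hs)

/-- In the basis `e_ρ`, `e_z` the coefficients are constant along a circle of latitude, so azimuthal
differentiation acts on `e_ρ` alone. -/
lemma u_circle (s : ℝ) : u (r • eR θ s) = (r⁻¹ * (w θ * sin θ + v θ * cos θ)) • eRho s
    + (r⁻¹ * (w θ * cos θ - v θ * sin θ)) • eZ := by
  rw [h.u_eq r hr θ hθ s, eR_eq, eTheta_eq]; module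

omit h hr hθ in
lemma hasDerivAt_circle (a b s : ℝ) :
    HasDerivAt (fun s => a • eRho s + b • eZ) (a • ePhi s) s :=
  ((hasDerivAt_eRho s).const_smul a).add_const _

omit h hr hθ in
lemma hasDerivAt_eR_azimuth (r θ s : ℝ) :
    HasDerivAt (fun s => r • eR θ s) ((r * sin θ) • ePhi s) s := by
  have h1 : (fun s => r • eR θ s) = fun s => (r * sin θ) • eRho s + (r * cos θ) • eZ := by
    funext s; rw [eR_eq]; module
  rw [h1]; exact hasDerivAt_circle _ _ s

lemma fderiv_u_ePhi : fderiv ℝ u (r • eR θ φ) (ePhi φ)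
    = ((r ^ 2)⁻¹ * (w θ + cos θ / sin θ * v θ)) • ePhi φ := by
  have hs := (sin_pos_of_pos_of_lt_pi hθ.1 hθ.2).ne'
  have key := fderiv_along_curve (t := φ) (γ := fun s => r • eR θ s) h.smooth_u
    (smul_eR_mem_offAxis hr hθ φ) (hasDerivAt_eR_azimuth r θ φ)
    (Eventually.of_forall (h.u_circle hr hθ)) (hasDerivAt_circle _ _ φ)
  rw [map_smul, ← eq_inv_smul_iff₀ (mul_ne_zero hr.ne' hs)] at key
  rw [key, smul_smul]; congr 1; field_simp

lemma fderiv_fderiv_u_ePhi : fderiv ℝ (fderiv ℝ u) (r • eR θ φ) (ePhi φ) (ePhi φ)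
    = (r ^ 3)⁻¹ • ((cos θ / sin θ * deriv w θ - 2 * w θ - 2 * (cos θ / sin θ) * v θ) • eR θ φ
      + (cos θ / sin θ * deriv v θ - v θ - (cos θ / sin θ) ^ 2 * v θ) • eTheta θ φ) := by
  have hs := (sin_pos_of_pos_of_lt_pi hθ.1 hθ.2).ne'
  have key := fderiv_fderiv_along_curve (t := φ) (γ := fun s => r • eR θ s)
    (γ₁ := fun s => (r * sin θ) • ePhi s) (γ₂ := (r * sin θ) • (-eRho φ)) h.smooth_u
    (Eventually.of_forall (smul_eR_mem_offAxis hr hθ)) (hasDerivAt_eR_azimuth r θ)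
    ((hasDerivAt_ePhi φ).const_smul (r * sin θ))
    (Eventually.of_forall (h.u_circle hr hθ)) (Eventually.of_forall (hasDerivAt_circle _ _))
    ((hasDerivAt_ePhi φ).const_smul (r⁻¹ * (w θ * sin θ + v θ * cos θ)))
  simp only [map_smul, map_neg, _root_.smul_apply] at key
  rw [← eq_sub_iff_add_eq,
    ← eq_inv_smul_iff₀ (mul_ne_zero hr.ne' hs),
    ← eq_inv_smul_iff₀ (mul_ne_zero hr.ne' hs)] at key
  rw [key, eRho_eq θ φ, map_add, map_smul, map_smul, h.fderiv_u_eR hr hθ φ,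
    h.fderiv_u_eTheta hr hθ φ]
  match_scalars <;> field_simp <;> ring

/-- The trace may be taken in the orthonormal frame at the given point, so no derivative of the
frame enters. The Laplacian below is treated in the same way. -/
lemma divergence_eq : divergence u (r • eR θ φ)
    = (r ^ 2)⁻¹ * (w θ + deriv v θ + cos θ / sin θ * v θ) := by
  have h1 : divergence u (r • eR θ φ) = LinearMap.trace ℝ E3 (fderiv ℝ u (r • eR θ φ)) := by
    rw [LinearMap.trace_eq_sum_inner _ (EuclideanSpace.basisFun (Fin 3) ℝ), divergence]
    refine Finset.sum_congr rfl fun i _ => ?_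
    rw [EuclideanSpace.basisFun_apply, EuclideanSpace.inner_single_left]; simp
  rw [h1, LinearMap.trace_eq_sum_inner _ (frame θ φ), Fin.sum_univ_three, frame_zero, frame_one,
    frame_two]
  simp only [ContinuousLinearMap.coe_coe]
  rw [h.fderiv_u_eR hr hθ, h.fderiv_u_eTheta hr hθ, h.fderiv_u_ePhi hr hθ]
  simp only [inner_smul_right, inner_add_right, inner_eR_eR, inner_eR_eTheta, inner_eTheta_eR,
    inner_eTheta_eTheta, inner_ePhi_ePhi]
  ring

lemma laplacian_eq : Laplacian.laplacian u (r • eR θ φ)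
    = (r ^ 3)⁻¹ • ((deriv (deriv w) θ + cos θ / sin θ * deriv w θ - 4 * w θ - 2 * deriv v θ
        - 2 * (cos θ / sin θ) * v θ + 2 * w θ) • eR θ φ
      + (deriv (deriv v) θ + 2 * deriv w θ + cos θ / sin θ * deriv v θ
        - (1 + (cos θ / sin θ) ^ 2) * v θ) • eTheta θ φ) := by
  rw [InnerProductSpace.laplacian_eq_iteratedFDeriv_orthonormalBasis u (frame θ φ)]
  simp only [iteratedFDeriv_two_apply, Fin.sum_univ_three, frame_zero, frame_one, frame_two,
    Matrix.cons_val_zero, Matrix.cons_val_one]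
  rw [h.fderiv_fderiv_u_eR hr hθ, h.fderiv_fderiv_u_eTheta hr hθ, h.fderiv_fderiv_u_ePhi hr hθ]
  match_scalars <;> ring

lemma convection_eq : fderiv ℝ u (r • eR θ φ) (u (r • eR θ φ))
    = (r ^ 3)⁻¹ • ((-w θ ^ 2 + v θ * deriv w θ - v θ ^ 2) • eR θ φ
      + (v θ * deriv v θ) • eTheta θ φ) := by
  rw [h.u_eq r hr θ hθ φ, map_smul, map_add, map_smul, map_smul, h.fderiv_u_eR hr hθ,
    h.fderiv_u_eTheta hr hθ]
  match_scalars <;> field_simp <;> ring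

end HasProfile

lemma inner_gradient (p : E3 → ℝ) (x y : E3) : ⟪gradient p x, y⟫_ℝ = fderiv ℝ p x y := by
  rw [gradient, InnerProductSpace.toDual_symm_apply]

lemma HasPressureProfile.gradient_eq {p : E3 → ℝ} {P : ℝ → ℝ} (h : HasPressureProfile p P)
    {r θ : ℝ} (hr : 0 < r) (hθ : θ ∈ Ioo 0 π) (φ : ℝ) : gradient p (r • eR θ φ)
    = (r ^ 3)⁻¹ • ((-2 * P θ) • eR θ φ + deriv P θ • eTheta θ φ) := by
  have hmem := smul_eR_mem_offAxis hr hθ φ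
  have hR : fderiv ℝ p (r • eR θ φ) (eR θ φ) = (r ^ 3)⁻¹ * (-2 * P θ) := by
    refine fderiv_along_curve (γ := fun s => s • eR θ φ) (g := fun s => (s ^ 2)⁻¹ * P θ)
      h.smooth_p hmem ?_ ?_ ?_
    · simpa using (hasDerivAt_id r).smul_const (eR θ φ)
    · filter_upwards [lt_mem_nhds hr] with s hs using h.p_eq s hs θ hθ φ
    · refine (((hasDerivAt_pow 2 r).inv (by positivity)).mul_const (P θ)).congr_deriv ?_
      field_simp; simp; ring
  have hT : fderiv ℝ p (r • eR θ φ) (eTheta θ φ) = (r ^ 3)⁻¹ * deriv P θ := by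
    have key := fderiv_along_curve (t := θ) (γ := fun s => r • eR s φ)
      (g := fun s => (r ^ 2)⁻¹ * P s) h.smooth_p hmem ((hasDerivAt_eR θ φ).const_smul r)
      (by filter_upwards [isOpen_Ioo.mem_nhds hθ] with s hs using h.p_eq r hr s hs φ)
      ((hasDerivAt_of_smooth isOpen_Ioo h.smooth_P hθ).const_mul _)
    rw [map_smul, smul_eq_mul] at key
    field_simp at key ⊢
    linarith
  have hΦ : fderiv ℝ p (r • eR θ φ) (ePhi φ) = 0 := by
    have hs := (sin_pos_of_pos_of_lt_pi hθ.1 hθ.2).ne'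
    have key := fderiv_along_curve (t := φ) (γ := fun s => r • eR θ s) h.smooth_p hmem
      (HasProfile.hasDerivAt_eR_azimuth r θ φ) (Eventually.of_forall (h.p_eq r hr θ hθ))
      (hasDerivAt_const _ _)
    rw [map_smul, smul_eq_mul] at key
    simpa [hr.ne', hs] using key
  rw [frame_expansion θ φ (gradient p (r • eR θ φ)), inner_gradient, inner_gradient, inner_gradient, hR, hT, hΦ]
  module

lemma HasProfile.momentum_eq {u : E3 → E3} {p : E3 → ℝ} {w v P : ℝ → ℝ} (h : HasProfile u w v)
    (h' : HasPressureProfile p P) {r θ : ℝ} (hr : 0 < r) (hθ : θ ∈ Ioo 0 π) (φ ν : ℝ) :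
    -(ν • Laplacian.laplacian u (r • eR θ φ)) + fderiv ℝ u (r • eR θ φ) (u (r • eR θ φ))
      + gradient p (r • eR θ φ)
    = (r ^ 3)⁻¹ • ((-ν * (deriv (deriv w) θ + cos θ / sin θ * deriv w θ - 2 * w θ
          - 2 * deriv v θ - 2 * (cos θ / sin θ) * v θ)
          - w θ ^ 2 + v θ * deriv w θ - v θ ^ 2 - 2 * P θ) • eR θ φ
      + (-ν * (deriv (deriv v) θ + 2 * deriv w θ + cos θ / sin θ * deriv v θ
          - (1 + (cos θ / sin θ) ^ 2) * v θ)
          + v θ * deriv v θ + deriv P θ) • eTheta θ φ) := by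
  rw [h.laplacian_eq hr hθ, h.convection_eq hr hθ, h'.gradient_eq hr hθ]
  module

/-! ### Reduction to a Riccati equation -/

/-- The function `(c₀ + c₁ cos θ + c₂ cos² θ) / sin² θ`. -/
def source (c : Fin 3 → ℝ) (θ : ℝ) : ℝ := (c 0 + c 1 * cos θ + c 2 * cos θ ^ 2) / sin θ ^ 2

/-- The Riccati equation satisfied by the polar profile of a solution with viscosity one. -/
def IsRiccati (c : Fin 3 → ℝ) (v : ℝ → ℝ) : Prop :=
  ∀ θ ∈ Ioo 0 π, HasDerivAt v (cos θ / sin θ * v θ + v θ ^ 2 / 2 - source c θ) θ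

/-- The radial profile belonging to a solution of the Riccati equation. -/
def radialProfile (c : Fin 3 → ℝ) (v : ℝ → ℝ) (θ : ℝ) : ℝ :=
  source c θ - 2 * (cos θ / sin θ) * v θ - v θ ^ 2 / 2

/-- The pressure profile belonging to a solution of the Riccati equation. -/
def pressureProfile (c : Fin 3 → ℝ) (v : ℝ → ℝ) (θ : ℝ) : ℝ :=
  radialProfile c v θ - v θ ^ 2 / 2 - c 2

lemma sin_pos_of_mem {θ : ℝ} (hθ : θ ∈ Ioo 0 π) : 0 < sin θ :=
  sin_pos_of_pos_of_lt_pi hθ.1 hθ.2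

lemma contDiffOn_cot : ContDiffOn ℝ ∞ (fun θ => cos θ / sin θ) (Ioo 0 π) :=
  contDiff_cos.contDiffOn.div contDiff_sin.contDiffOn fun _ hθ => (sin_pos_of_mem hθ).ne'

lemma contDiffOn_source (c : Fin 3 → ℝ) : ContDiffOn ℝ ∞ (source c) (Ioo 0 π) := by
  have h1 : ContDiff ℝ ∞ fun θ => c 0 + c 1 * cos θ + c 2 * cos θ ^ 2 := by fun_prop
  have h2 : ContDiff ℝ ∞ fun θ => sin θ ^ 2 := by fun_prop
  exact h1.contDiffOn.div h2.contDiffOn fun _ hθ => pow_ne_zero _ (sin_pos_of_mem hθ).ne'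

lemma contDiffOn_radialProfile (c : Fin 3 → ℝ) {v : ℝ → ℝ} (hv : ContDiffOn ℝ ∞ v (Ioo 0 π)) :
    ContDiffOn ℝ ∞ (radialProfile c v) (Ioo 0 π) :=
  ((contDiffOn_source c).sub ((contDiffOn_const.mul contDiffOn_cot).mul hv)).sub
    ((hv.pow 2).div_const 2)

lemma contDiffOn_pressureProfile (c : Fin 3 → ℝ) {v : ℝ → ℝ}
    (hv : ContDiffOn ℝ ∞ v (Ioo 0 π)) : ContDiffOn ℝ ∞ (pressureProfile c v) (Ioo 0 π) :=
  ((contDiffOn_radialProfile c hv).sub ((hv.pow 2).div_const 2)).sub contDiffOn_const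

/-- Bootstrap: the right-hand side is a polynomial in `v` with smooth coefficients, so `v'` is as
regular as `v`. -/
lemma IsRiccati.contDiffOn {c : Fin 3 → ℝ} {v : ℝ → ℝ} (h : IsRiccati c v) :
    ContDiffOn ℝ ∞ v (Ioo 0 π) := by
  have hd : DifferentiableOn ℝ v (Ioo 0 π) := fun θ hθ =>
    (h θ hθ).differentiableAt.differentiableWithinAt
  rw [contDiffOn_infty]
  intro n
  induction n with
  | zero => exact contDiffOn_zero.2 hd.continuousOn
  | succ n ih =>
    push_cast
    rw [contDiffOn_succ_iff_deriv_of_isOpen isOpen_Ioo]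
    refine ⟨hd, by simp, ?_⟩
    have hle : (n : ℕ∞ω) ≤ (∞ : ℕ∞ω) := by exact_mod_cast le_top
    refine ContDiffOn.congr ?_ fun θ hθ => (h θ hθ).deriv
    exact (((contDiffOn_cot.of_le hle).mul ih).add ((ih.pow 2).div_const 2)).sub
      ((contDiffOn_source c).of_le hle)

lemma exists_const_of_hasDerivAt_zero {f : ℝ → ℝ}
    (h : ∀ θ ∈ Ioo 0 π, HasDerivAt f 0 θ) : ∃ a, ∀ θ ∈ Ioo 0 π, f θ = a := by
  refine isOpen_Ioo.exists_is_const_of_deriv_eq_zero isPreconnected_Ioo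
    (fun θ hθ => (h θ hθ).differentiableAt.differentiableWithinAt) fun θ hθ => (h θ hθ).deriv

lemma hasDerivAt_cot {θ : ℝ} (hθ : θ ∈ Ioo 0 π) :
    HasDerivAt (fun t => cos t / sin t) (-(1 + (cos θ / sin θ) ^ 2)) θ := by
  have hs := (sin_pos_of_mem hθ).ne'
  refine ((hasDerivAt_cos θ).div (hasDerivAt_sin θ) hs).congr_deriv ?_
  field_simp
  ring

/-- Three successive integrations. The derivative of the divergence equation removes `v''` from the
polar momentum equation, leaving `(w - v² / 2 - P)' = 0`. With `P` eliminated, `sin θ` times the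
radial equation is an exact derivative. Its integral, multiplied by `sin θ`, is exact once more. The
divergence equation finally turns the formula for `w` into the Riccati equation. -/
lemma exists_riccati_of_equations {w w₁ w₂ v v₁ v₂ P P₁ : ℝ → ℝ}
    (hw : ∀ θ ∈ Ioo 0 π, HasDerivAt w (w₁ θ) θ) (hw₁ : ∀ θ ∈ Ioo 0 π, HasDerivAt w₁ (w₂ θ) θ)
    (hv : ∀ θ ∈ Ioo 0 π, HasDerivAt v (v₁ θ) θ) (hv₁ : ∀ θ ∈ Ioo 0 π, HasDerivAt v₁ (v₂ θ) θ)
    (hP : ∀ θ ∈ Ioo 0 π, HasDerivAt P (P₁ θ) θ)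
    (hdiv : ∀ θ ∈ Ioo 0 π, w θ + v₁ θ + cos θ / sin θ * v θ = 0)
    (hr : ∀ θ ∈ Ioo 0 π, -(w₂ θ + cos θ / sin θ * w₁ θ - 2 * w θ - 2 * v₁ θ
      - 2 * (cos θ / sin θ) * v θ) - w θ ^ 2 + v θ * w₁ θ - v θ ^ 2 - 2 * P θ = 0)
    (hθ : ∀ θ ∈ Ioo 0 π, -(v₂ θ + 2 * w₁ θ + cos θ / sin θ * v₁ θ
      - (1 + (cos θ / sin θ) ^ 2) * v θ) + v θ * v₁ θ + P₁ θ = 0) :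
    ∃ c : Fin 3 → ℝ, IsRiccati c v ∧ ∀ θ ∈ Ioo 0 π,
      w θ = radialProfile c v θ ∧ P θ = pressureProfile c v θ := by
  have hdiv' : ∀ θ ∈ Ioo 0 π,
      w₁ θ + v₂ θ + (-(1 + (cos θ / sin θ) ^ 2) * v θ + cos θ / sin θ * v₁ θ) = 0 := by
    intro θ h
    have h1 := ((hw θ h).add (hv₁ θ h)).add ((hasDerivAt_cot h).mul (hv θ h))
    refine h1.unique ((hasDerivAt_const θ (0 : ℝ)).congr_of_eventuallyEq ?_)
    filter_upwards [isOpen_Ioo.mem_nhds h] with t ht using hdiv t ht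
  -- First integral: a Bernoulli-type law from the polar momentum equation.
  obtain ⟨c₂, hc₂⟩ := exists_const_of_hasDerivAt_zero
    (f := fun θ => w θ - v θ ^ 2 / 2 - P θ) fun θ h => by
      refine (((hw θ h).sub (((hv θ h).pow 2).div_const 2)).sub (hP θ h)).congr_deriv ?_
      simp only [Nat.cast_ofNat]
      linear_combination -hdiv' θ h - hθ θ h
  -- Second integral. By incompressibility `-w² = w (v' + cot θ · v)`, which is what makes the
  -- convective terms combine into `(sin θ · v w)' / sin θ`.
  obtain ⟨c₁, hc₁⟩ := exists_const_of_hasDerivAt_zero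
    (f := fun θ => sin θ * (w₁ θ - 2 * v θ - v θ * w θ) + 2 * c₂ * cos θ) fun θ h => by
      have hs := (sin_pos_of_mem h).ne'
      refine (((hasDerivAt_sin θ).mul (((hw₁ θ h).sub ((hv θ h).const_mul 2)).sub
        ((hv θ h).mul (hw θ h)))).add ((hasDerivAt_cos θ).const_mul (2 * c₂))).congr_deriv ?_
      have e1 := hdiv θ h
      have e2 := hr θ h
      have e3 := hc₂ θ h
      have hcs : sin θ * (cos θ / sin θ) = cos θ := by field_simp
      simp only [Pi.sub_apply, Pi.mul_apply]
      rw [← hcs]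
      linear_combination (-sin θ) * e2 + 2 * sin θ * e3 - sin θ * w θ * e1
  obtain ⟨c₀, hc₀⟩ := exists_const_of_hasDerivAt_zero
    (f := fun θ => sin θ ^ 2 * w θ + 2 * (sin θ * cos θ) * v θ + sin θ ^ 2 * (v θ ^ 2 / 2)
      + c₁ * cos θ - c₂ * cos θ ^ 2) fun θ h => by
      have hs := (sin_pos_of_mem h).ne'
      refine (((((((hasDerivAt_sin θ).pow 2).mul (hw θ h)).add
        ((((hasDerivAt_sin θ).mul (hasDerivAt_cos θ)).const_mul 2).mul (hv θ h))).add
        (((hasDerivAt_sin θ).pow 2).mul (((hv θ h).pow 2).div_const 2))).add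
        ((hasDerivAt_cos θ).const_mul c₁)).sub
        (((hasDerivAt_cos θ).pow 2).const_mul c₂)).congr_deriv ?_
      have e1 := hdiv θ h
      have e2 := hc₁ θ h
      have e4 : v₁ θ = - w θ - cos θ / sin θ * v θ := by linarith
      simp only [Pi.mul_apply, Pi.pow_apply]
      rw [e4, ← e2]
      field_simp
      simp
      ring
  -- The minus sign on `c₁` comes from moving `c₁ cos θ` to the right-hand side of the third
  -- integral.
  have hw' : ∀ θ ∈ Ioo 0 π, w θ = radialProfile ![c₀, -c₁, c₂] v θ := by
    intro θ h
    have hs := (sin_pos_of_mem h).ne'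
    have e := hc₀ θ h
    simp [radialProfile, source]
    field_simp
    linear_combination 2 * e
  refine ⟨![c₀, -c₁, c₂], fun θ h => (hv θ h).congr_deriv ?_, fun θ h => ⟨hw' θ h, ?_⟩⟩
  · have e1 := hdiv θ h
    have e2 := hw' θ h
    rw [radialProfile] at e2
    linear_combination e1 - e2
  · have e3 := hc₂ θ h
    rw [pressureProfile, ← hw' θ h]
    simp
    linear_combination -e3

/-- The integrations run backwards. The Riccati equation is the divergence equation for
`radialProfile`; differentiating that profile gives `w' = 2 v + v w - (c₁ + 2 c₂ cos θ) / sin θ`,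
and one more derivative gives the radial equation. -/
lemma equations_of_riccati {c : Fin 3 → ℝ} {v : ℝ → ℝ} (h : IsRiccati c v) {θ : ℝ}
    (hθ : θ ∈ Ioo 0 π) :
    radialProfile c v θ + deriv v θ + cos θ / sin θ * v θ = 0 ∧
    -(deriv (deriv (radialProfile c v)) θ + cos θ / sin θ * deriv (radialProfile c v) θ
      - 2 * radialProfile c v θ - 2 * deriv v θ - 2 * (cos θ / sin θ) * v θ)
      - radialProfile c v θ ^ 2 + v θ * deriv (radialProfile c v) θ - v θ ^ 2
      - 2 * pressureProfile c v θ = 0 ∧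
    -(deriv (deriv v) θ + 2 * deriv (radialProfile c v) θ + cos θ / sin θ * deriv v θ
      - (1 + (cos θ / sin θ) ^ 2) * v θ) + v θ * deriv v θ
      + deriv (pressureProfile c v) θ = 0 := by
  have hdiv : ∀ t ∈ Ioo 0 π, deriv v t = -radialProfile c v t - cos t / sin t * v t := by
    intro t ht
    rw [(h t ht).deriv, radialProfile]; ring
  have hsource : ∀ t ∈ Ioo 0 π, HasDerivAt (source c)
      (-(c 1 + 2 * c 2 * cos t) / sin t - 2 * (cos t / sin t) * source c t) t := by
    intro t ht
    have hs := (sin_pos_of_mem ht).ne'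
    refine (((((hasDerivAt_cos t).const_mul (c 1)).const_add (c 0)).add
      (((hasDerivAt_cos t).pow 2).const_mul (c 2))).div ((hasDerivAt_sin t).pow 2)
      (pow_ne_zero 2 hs)).congr_deriv ?_
    simp [source]
    field_simp
    ring
  have hw : ∀ t ∈ Ioo 0 π, HasDerivAt (radialProfile c v)
      (2 * v t + v t * radialProfile c v t - (c 1 + 2 * c 2 * cos t) / sin t) t := by
    intro t ht
    have hv := h t ht
    rw [← hv.deriv, hdiv t ht] at hv
    refine (((hsource t ht).sub (((hasDerivAt_cot ht).const_mul 2).mul hv)).sub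
      ((hv.pow 2).div_const 2)).congr_deriv ?_
    simp [radialProfile]
    ring
  have hw2 : HasDerivAt (deriv (radialProfile c v))
      (2 * deriv v θ + (deriv v θ * radialProfile c v θ + v θ * deriv (radialProfile c v) θ)
        + 2 * c 2 + (c 1 + 2 * c 2 * cos θ) * cos θ / sin θ ^ 2) θ := by
    have hs := (sin_pos_of_mem hθ).ne'
    have hv := h θ hθ
    rw [← hv.deriv] at hv
    have hwθ := hw θ hθ
    rw [← hwθ.deriv] at hwθ
    have h1 := ((hv.const_mul 2).add (hv.mul hwθ)).sub
      ((((hasDerivAt_cos θ).const_mul (2 * c 2)).const_add (c 1)).div (hasDerivAt_sin θ) hs)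
    refine HasDerivAt.congr_of_eventuallyEq (h1.congr_deriv ?_) ?_
    · field_simp
      ring
    · filter_upwards [isOpen_Ioo.mem_nhds hθ] with t ht using (hw t ht).deriv
  have hv := h θ hθ
  rw [← hv.deriv] at hv
  have hv2 : HasDerivAt (deriv v) (-deriv (radialProfile c v) θ
      - (-(1 + (cos θ / sin θ) ^ 2) * v θ + cos θ / sin θ * deriv v θ)) θ := by
    have hwθ := hw θ hθ
    rw [← hwθ.deriv] at hwθ
    refine HasDerivAt.congr_of_eventuallyEq (hwθ.neg.sub ((hasDerivAt_cot hθ).mul hv)) ?_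
    filter_upwards [isOpen_Ioo.mem_nhds hθ] with t ht using hdiv t ht
  have hP : HasDerivAt (pressureProfile c v) (deriv (radialProfile c v) θ - v θ * deriv v θ) θ := by
    have hwθ := hw θ hθ
    rw [← hwθ.deriv] at hwθ
    refine ((hwθ.sub ((hv.pow 2).div_const 2)).sub_const (c 2)).congr_deriv ?_
    simp; ring
  have e := hdiv θ hθ
  refine ⟨by rw [e]; ring, ?_, ?_⟩
  · rw [hw2.deriv, pressureProfile, (hw θ hθ).deriv, e]
    ring
  · rw [hv2.deriv, hP.deriv]
    ring

/-! ### Solutions and their profiles -/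

/-- Under this scaling every term of the momentum equation at viscosity `ν` is multiplied by `ν⁻²`,
and the viscosity becomes one. -/
lemma IsSolution.rescale {ν : ℝ} {u : E3 → E3} {p : E3 → ℝ} (h : IsSolution ν u p)
    (hν : 0 < ν) : IsSolution 1 (ν⁻¹ • u) ((ν ^ 2)⁻¹ • p) where
  smooth_u := h.smooth_u.const_smul (ν⁻¹)
  smooth_p := h.smooth_p.const_smul ((ν ^ 2)⁻¹)
  homogeneous_u x hx t ht := by
    simp only [Pi.smul_apply, h.homogeneous_u x hx t ht, smul_comm ν⁻¹]
  homogeneous_p x hx t ht := by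
    simp only [Pi.smul_apply, h.homogeneous_p x hx t ht, smul_eq_mul]; ring
  axisymmetric r hr θ hθ φ φ' := by
    obtain ⟨h1, h2, h3⟩ := h.axisymmetric r hr θ hθ φ φ'
    simp only [compR, compTheta, compPhi, Pi.smul_apply, real_inner_smul_left] at *
    rw [h1, h2, h3]; simp
  noSwirl r hr θ hθ φ := by
    have h1 := h.noSwirl r hr θ hθ φ
    simp only [compPhi, Pi.smul_apply, real_inner_smul_left] at *
    rw [h1, mul_zero]
  momentum x hx := by
    have hux := h.smooth_u.contDiffAt (isOpen_offAxis.mem_nhds hx)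
    have hpx := h.smooth_p.contDiffAt (isOpen_offAxis.mem_nhds hx)
    have hg : gradient ((ν ^ 2)⁻¹ • p) x = (ν ^ 2)⁻¹ • gradient p x := by
      rw [gradient, fderiv_const_smul (hpx.differentiableAt (by simp)), map_smul, gradient]
    rw [InnerProductSpace.laplacian_smul _ (hux.of_le (WithTop.coe_le_coe.2 le_top)),
      fderiv_const_smul (hux.differentiableAt (by simp)), hg, Pi.smul_apply, map_smul,
      _root_.smul_apply]
    have h0 := congrArg (fun y => (ν ^ 2)⁻¹ • y) (h.momentum x hx)
    simp only [smul_zero] at h0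
    rw [← h0]
    match_scalars <;> field_simp
  incompressible x hx := by
    have hux := h.smooth_u.contDiffAt (isOpen_offAxis.mem_nhds hx)
    have h0 := h.incompressible x hx
    rw [divergence] at h0 ⊢
    rw [fderiv_const_smul (hux.differentiableAt (by simp))]
    simp only [_root_.smul_apply, PiLp.smul_apply, ← Finset.smul_sum]
    rw [h0, smul_zero]

lemma contDiff_eR (φ : ℝ) : ContDiff ℝ ∞ fun θ => eR θ φ := by
  simp only [eR_eq]; fun_prop

lemma contDiff_eTheta (φ : ℝ) : ContDiff ℝ ∞ fun θ => eTheta θ φ := by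
  simp only [eTheta_eq]; fun_prop

lemma contDiffOn_comp_meridian {F : Type*} [NormedAddCommGroup F] [NormedSpace ℝ F] {f : E3 → F}
    (hf : ContDiffOn ℝ ∞ f offAxis) (φ : ℝ) :
    ContDiffOn ℝ ∞ (fun θ => f ((1 : ℝ) • eR θ φ)) (Ioo 0 π) :=
  hf.comp ((contDiff_const (c := (1 : ℝ))).smul (contDiff_eR φ)).contDiffOn
    fun _ hθ => smul_eR_mem_offAxis one_pos hθ φ

lemma IsSolution.hasProfile {ν : ℝ} {u : E3 → E3} {p : E3 → ℝ} (h : IsSolution ν u p) :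
    HasProfile u (fun θ => compR u 1 θ 0) (fun θ => compTheta u 1 θ 0) where
  smooth_u := h.smooth_u
  smooth_w := (contDiffOn_comp_meridian h.smooth_u 0).inner ℝ (contDiff_eR 0).contDiffOn
  smooth_v := (contDiffOn_comp_meridian h.smooth_u 0).inner ℝ (contDiff_eTheta 0).contDiffOn
  u_eq r hr θ hθ φ := by
    have h1 := h.homogeneous_u _ (smul_eR_mem_offAxis one_pos hθ φ) r hr
    rw [smul_smul, mul_one] at h1
    obtain ⟨e1, e2, -⟩ := h.axisymmetric 1 one_pos θ hθ 0 φ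
    have e3 := h.noSwirl 1 one_pos θ hθ φ
    rw [h1]
    simp only [e1, e2]
    rw [frame_expansion θ φ (u ((1 : ℝ) • eR θ φ))]
    simp only [compR, compTheta, compPhi] at e3 ⊢
    rw [e3]; module

/-- Axial symmetry of the pressure is not part of the definition of a solution. It holds because the
Laplacian and the convection term have no `e_φ` component, so the momentum equation forces `∂_φ p =
0`. -/
lemma IsSolution.hasPressureProfile {ν : ℝ} {u : E3 → E3} {p : E3 → ℝ} (h : IsSolution ν u p) :
    HasPressureProfile p (fun θ => p ((1 : ℝ) • eR θ 0)) where
  smooth_p := h.smooth_p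
  smooth_P := contDiffOn_comp_meridian h.smooth_p 0
  p_eq r hr θ hθ φ := by
    have h1 := h.homogeneous_p _ (smul_eR_mem_offAxis one_pos hθ φ) r hr
    rw [smul_smul, mul_one] at h1
    rw [h1]
    congr 1
    have hd : ∀ s, HasDerivAt (fun s => p ((1 : ℝ) • eR θ s)) 0 s := by
      intro s
      have hmem := smul_eR_mem_offAxis one_pos hθ s
      have hp : DifferentiableAt ℝ p ((1 : ℝ) • eR θ s) :=
        (h.smooth_p.contDiffAt (isOpen_offAxis.mem_nhds hmem)).differentiableAt (by simp)
      refine (hp.hasFDerivAt.comp_hasDerivAt s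
        (HasProfile.hasDerivAt_eR_azimuth 1 θ s)).congr_deriv ?_
      have hm := h.momentum _ hmem
      rw [h.hasProfile.laplacian_eq one_pos hθ, h.hasProfile.convection_eq one_pos hθ] at hm
      have hm2 := congrArg (fun y => ⟪y, ePhi s⟫_ℝ) hm
      simp only [inner_add_left, inner_neg_left, real_inner_smul_left, inner_eR_ePhi,
        inner_eTheta_ePhi, inner_gradient, inner_zero_left] at hm2
      rw [map_smul, smul_eq_mul]
      linear_combination (1 * sin θ) * hm2
    exact is_const_of_deriv_eq_zero (fun s => (hd s).differentiableAt) (fun s => (hd s).deriv) φ 0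

lemma smul_frame_eq_zero {r a b θ φ : ℝ} (hr : r ≠ 0)
    (h : r • (a • eR θ φ + b • eTheta θ φ) = 0) : a = 0 ∧ b = 0 := by
  have h1 := congrArg (fun y => ⟪y, eR θ φ⟫_ℝ) h
  have h2 := congrArg (fun y => ⟪y, eTheta θ φ⟫_ℝ) h
  simp only [inner_add_left, real_inner_smul_left, inner_eR_eTheta, inner_eTheta_eR, inner_eR_eR,
    inner_eTheta_eTheta, inner_zero_left, mul_zero, mul_one, add_zero, zero_add, mul_eq_zero, hr,
    false_or] at h1 h2
  exact ⟨h1, h2⟩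

lemma HasProfile.congr {u : E3 → E3} {w w' v : ℝ → ℝ} (h : HasProfile u w v)
    (hw : ∀ θ ∈ Ioo 0 π, w' θ = w θ) : HasProfile u w' v where
  smooth_u := h.smooth_u
  smooth_w := h.smooth_w.congr hw
  smooth_v := h.smooth_v
  u_eq r hr θ hθ φ := by rw [hw θ hθ, h.u_eq r hr θ hθ φ]

lemma HasPressureProfile.congr {p : E3 → ℝ} {P P' : ℝ → ℝ} (h : HasPressureProfile p P)
    (hP : ∀ θ ∈ Ioo 0 π, P' θ = P θ) : HasPressureProfile p P' where
  smooth_p := h.smooth_p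
  smooth_P := h.smooth_P.congr hP
  p_eq r hr θ hθ φ := by rw [hP θ hθ, h.p_eq r hr θ hθ φ]

lemma IsSolution.exists_riccati {u : E3 → E3} {p : E3 → ℝ} (h : IsSolution 1 u p) :
    ∃ (c : Fin 3 → ℝ) (v : ℝ → ℝ), IsRiccati c v ∧ HasProfile u (radialProfile c v) v ∧
      HasPressureProfile p (pressureProfile c v) := by
  have hu := h.hasProfile
  have hp := h.hasPressureProfile
  set w := fun θ => compR u 1 θ 0
  set v := fun θ => compTheta u 1 θ 0
  set P := fun θ => p ((1 : ℝ) • eR θ 0)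
  have hO : IsOpen (Ioo 0 π) := isOpen_Ioo
  have hm : ∀ θ ∈ Ioo 0 π, _ := fun θ hθ => smul_frame_eq_zero (by norm_num)
    ((hu.momentum_eq hp one_pos hθ 0 1).symm.trans
      (h.momentum _ (smul_eR_mem_offAxis one_pos hθ 0)))
  obtain ⟨c, hc, hwP⟩ := exists_riccati_of_equations (w := w) (v := v) (P := P)
    (fun θ hθ => hasDerivAt_of_smooth hO hu.smooth_w hθ)
    (fun θ hθ => hasDerivAt_of_smooth hO (contDiffOn_deriv hO hu.smooth_w) hθ)
    (fun θ hθ => hasDerivAt_of_smooth hO hu.smooth_v hθ)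
    (fun θ hθ => hasDerivAt_of_smooth hO (contDiffOn_deriv hO hu.smooth_v) hθ)
    (fun θ hθ => hasDerivAt_of_smooth hO hp.smooth_P hθ)
    (fun θ hθ => by
      have h1 := h.incompressible _ (smul_eR_mem_offAxis one_pos hθ 0)
      rw [hu.divergence_eq one_pos hθ] at h1
      simpa using h1)
    (fun θ hθ => by linear_combination (hm θ hθ).1)
    (fun θ hθ => by linear_combination (hm θ hθ).2)
  exact ⟨c, v, hc, hu.congr fun θ hθ => ((hwP θ hθ).1).symm,
    hp.congr fun θ hθ => ((hwP θ hθ).2).symm⟩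

lemma HasProfile.compTheta_eq {u : E3 → E3} {w v : ℝ → ℝ} (h : HasProfile u w v) {r θ : ℝ}
    (hr : 0 < r) (hθ : θ ∈ Ioo 0 π) (φ : ℝ) : compTheta u r θ φ = r⁻¹ * v θ := by
  rw [compTheta, h.u_eq r hr θ hθ φ]
  simp only [inner_add_left, real_inner_smul_left, inner_eR_eTheta, inner_eTheta_eTheta]
  ring

lemma HasProfile.compR_eq {u : E3 → E3} {w v : ℝ → ℝ} (h : HasProfile u w v) {r θ : ℝ}
    (hr : 0 < r) (hθ : θ ∈ Ioo 0 π) (φ : ℝ) : compR u r θ φ = r⁻¹ * w θ := by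
  rw [compR, h.u_eq r hr θ hθ φ]
  simp only [inner_add_left, real_inner_smul_left, inner_eTheta_eR, inner_eR_eR]
  ring

lemma HasProfile.compPhi_eq {u : E3 → E3} {w v : ℝ → ℝ} (h : HasProfile u w v) {r θ : ℝ}
    (hr : 0 < r) (hθ : θ ∈ Ioo 0 π) (φ : ℝ) : compPhi u r θ φ = 0 := by
  rw [compPhi, h.u_eq r hr θ hθ φ]
  simp [inner_add_left, real_inner_smul_left, inner_eTheta_ePhi, inner_eR_ePhi]

/-- The velocity field with given profiles. -/
def profileField (w v : ℝ → ℝ) (x : E3) : E3 :=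
  ‖x‖⁻¹ • (w (polar x) • (‖x‖⁻¹ • x) + v (polar x) • fieldTheta x)

/-- The pressure with a given profile. -/
def profilePressure (P : ℝ → ℝ) (x : E3) : ℝ := (‖x‖ ^ 2)⁻¹ * P (polar x)

lemma contDiffOn_comp_polar {f : ℝ → ℝ} (hf : ContDiffOn ℝ ∞ f (Ioo 0 π)) :
    ContDiffOn ℝ ∞ (fun x => f (polar x)) offAxis :=
  hf.comp contDiffOn_polar fun _ hx => polar_mem hx

lemma contDiffOn_inv_norm : ContDiffOn ℝ ∞ (fun x : E3 => ‖x‖⁻¹) offAxis :=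
  contDiffOn_norm_offAxis.inv fun _ hx => (norm_pos_of_mem_offAxis hx).ne'

lemma inv_smul_smul_eR {r : ℝ} (hr : 0 < r) (θ φ : ℝ) :
    ‖r • eR θ φ‖⁻¹ • (r • eR θ φ) = eR θ φ := by
  rw [norm_smul_eR hr, smul_smul, inv_mul_cancel₀ hr.ne', one_smul]

lemma hasProfile_profileField {w v : ℝ → ℝ} (hw : ContDiffOn ℝ ∞ w (Ioo 0 π))
    (hv : ContDiffOn ℝ ∞ v (Ioo 0 π)) : HasProfile (profileField w v) w v where
  smooth_u := contDiffOn_inv_norm.smul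
    (((contDiffOn_comp_polar hw).smul (contDiffOn_inv_norm.smul contDiffOn_id)).add
      ((contDiffOn_comp_polar hv).smul contDiffOn_fieldTheta))
  smooth_w := hw
  smooth_v := hv
  u_eq r hr θ hθ φ := by
    rw [profileField, polar_smul_eR hr hθ, fieldTheta_smul_eR hr hθ, inv_smul_smul_eR hr,
      norm_smul_eR hr]

lemma hasPressureProfile_profilePressure {P : ℝ → ℝ} (hP : ContDiffOn ℝ ∞ P (Ioo 0 π)) :
    HasPressureProfile (profilePressure P) P where
  smooth_p := ((contDiffOn_norm_offAxis.pow 2).inv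
    fun _ hx => pow_ne_zero 2 (norm_pos_of_mem_offAxis hx).ne').mul (contDiffOn_comp_polar hP)
  smooth_P := hP
  p_eq r hr θ hθ φ := by
    rw [profilePressure, polar_smul_eR hr hθ, norm_smul_eR hr]

lemma isSolution_of_riccati {c : Fin 3 → ℝ} {v : ℝ → ℝ} (h : IsRiccati c v) :
    IsSolution 1 (profileField (radialProfile c v) v)
      (profilePressure (pressureProfile c v)) := by
  have hv := h.contDiffOn
  have hu := hasProfile_profileField (contDiffOn_radialProfile c hv) hv
  have hp := hasPressureProfile_profilePressure (contDiffOn_pressureProfile c hv)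
  refine ⟨hu.smooth_u, hp.smooth_p, ?_, ?_, ?_, ?_, ?_, ?_⟩
  · intro x hx t ht
    obtain ⟨θ, hθ, φ, hx'⟩ := exists_spherical hx
    have hn := norm_pos_of_mem_offAxis hx
    rw [hx', smul_smul, hu.u_eq _ (mul_pos ht hn) θ hθ, hu.u_eq _ hn θ hθ, smul_smul, mul_inv]
  · intro x hx t ht
    obtain ⟨θ, hθ, φ, hx'⟩ := exists_spherical hx
    have hn := norm_pos_of_mem_offAxis hx
    rw [hx', smul_smul, hp.p_eq _ (mul_pos ht hn) θ hθ, hp.p_eq _ hn θ hθ, mul_pow, mul_inv,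
      mul_assoc]
  · intro r hr θ hθ φ φ'
    rw [hu.compR_eq hr hθ, hu.compR_eq hr hθ, hu.compTheta_eq hr hθ, hu.compTheta_eq hr hθ,
      hu.compPhi_eq hr hθ, hu.compPhi_eq hr hθ]
    simp
  · intro r hr θ hθ φ
    exact hu.compPhi_eq hr hθ φ
  · intro x hx
    obtain ⟨θ, hθ, φ, hx'⟩ := exists_spherical hx
    have hn := norm_pos_of_mem_offAxis hx
    obtain ⟨-, e2, e3⟩ := equations_of_riccati h hθ
    rw [hx', hu.momentum_eq hp hn hθ, neg_one_mul, neg_one_mul, e2, e3]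
    simp
  · intro x hx
    obtain ⟨θ, hθ, φ, hx'⟩ := exists_spherical hx
    have hn := norm_pos_of_mem_offAxis hx
    rw [hx', hu.divergence_eq hn hθ, (equations_of_riccati h hθ).1, mul_zero]

/-- The energy of the polar component in terms of its profile. -/
lemma HasProfile.bandEnergy_eq {u : E3 → E3} {w v : ℝ → ℝ} (h : HasProfile u w v) {a b : ℝ}
    (ha : 0 < a) (hab : a ≤ b) (hb : b < π) :
    bandEnergy u a b = 2 * π * ∫ θ in a..b, v θ ^ 2 * sin θ := by
  rw [bandEnergy, ← intervalIntegral.integral_const_mul]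
  refine intervalIntegral.integral_congr fun θ hθ => ?_
  rw [uIcc_of_le hab] at hθ
  have hθ' : θ ∈ Ioo 0 π := ⟨ha.trans_le hθ.1, hθ.2.trans_lt hb⟩
  simp only [h.compTheta_eq one_pos hθ']
  simp
  ring

lemma bandEnergy_smul (t : ℝ) (u : E3 → E3) (a b : ℝ) :
    bandEnergy (t • u) a b = t ^ 2 * bandEnergy u a b := by
  simp only [bandEnergy, compTheta, Pi.smul_apply, real_inner_smul_left, abs_mul, mul_pow, sq_abs,
    mul_assoc, intervalIntegral.integral_const_mul]

/-! ### Energy estimates for the Riccati equation -/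

lemma mem_Ioo_of_mem_Icc {a b t : ℝ} (ha : 0 < a) (hb : b < π) (ht : t ∈ Icc a b) :
    t ∈ Ioo 0 π := ⟨ha.trans_le ht.1, ht.2.trans_lt hb⟩

lemma intervalIntegrable_of_continuousOn_Ioo {f : ℝ → ℝ} (hf : ContinuousOn f (Ioo 0 π))
    {a b : ℝ} (ha : a ∈ Ioo 0 π) (hb : b ∈ Ioo 0 π) : IntervalIntegrable f volume a b :=
  (hf.mono (ordConnected_Ioo.uIcc_subset ha hb)).intervalIntegrable

lemma exists_sin_lower_bound {a b : ℝ} (ha : 0 < a) (hb : b < π) :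
    ∃ s > 0, ∀ t ∈ Icc a b, s ≤ sin t := by
  rcases (Icc a b).eq_empty_or_nonempty with he | hne
  · exact ⟨1, one_pos, by simp [he]⟩
  · obtain ⟨t, ht, hmin⟩ := isCompact_Icc.exists_isMinOn hne continuous_sin.continuousOn
    exact ⟨sin t, sin_pos_of_mem (mem_Ioo_of_mem_Icc ha hb ht), fun s hs => hmin hs⟩

/-- The polynomial `c₀ + c₁ x + c₂ x²` evaluated at `x = cos θ`. -/
def cosPoly (c : Fin 3 → ℝ) (θ : ℝ) : ℝ := c 0 + c 1 * cos θ + c 2 * cos θ ^ 2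

lemma abs_cosPoly_le (c : Fin 3 → ℝ) (θ : ℝ) : |cosPoly c θ| ≤ 3 * ‖c‖ := by
  have h0 := norm_le_pi_norm c 0
  have h1 := norm_le_pi_norm c 1
  have h2 := norm_le_pi_norm c 2
  rw [Real.norm_eq_abs] at h0 h1 h2
  have hc := abs_cos_le_one θ
  have e1 : |c 1 * cos θ| ≤ ‖c‖ := by
    rw [abs_mul]; nlinarith [abs_nonneg (c 1), abs_nonneg (cos θ)]
  have e2 : |c 2 * cos θ ^ 2| ≤ ‖c‖ := by
    rw [abs_mul, abs_pow]
    nlinarith [abs_nonneg (c 2), abs_nonneg (cos θ), pow_le_one₀ (n := 2) (abs_nonneg (cos θ)) hc]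
  have := abs_add_three (c 0) (c 1 * cos θ) (c 2 * cos θ ^ 2)
  rw [cosPoly]; linarith

/-- A polynomial of degree at most two that vanishes at three distinct values of `cos` is zero;
divided differences at the three quarter points of `(a, b)` show this. -/
lemma exists_cosPoly_ne_zero {c : Fin 3 → ℝ} (hc : c ≠ 0) {a b : ℝ} (ha : 0 < a) (hab : a < b)
    (hb : b < π) : ∃ t ∈ Ioo a b, cosPoly c t ≠ 0 := by
  by_contra! hcon
  have hlt : ∀ s t, a < s → s < t → t < b → cos t < cos s := fun s t h1 h2 h3 =>
    cos_lt_cos_of_nonneg_of_le_pi (by linarith) (by linarith) h2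
  set t₁ := (3 * a + b) / 4 with ht₁
  set t₂ := (2 * a + 2 * b) / 4 with ht₂
  set t₃ := (a + 3 * b) / 4 with ht₃
  have e1 := hcon t₁ ⟨by linarith, by linarith⟩
  have e2 := hcon t₂ ⟨by linarith, by linarith⟩
  have e3 := hcon t₃ ⟨by linarith, by linarith⟩
  have l1 := hlt t₁ t₂ (by linarith) (by linarith) (by linarith)
  have l2 := hlt t₂ t₃ (by linarith) (by linarith) (by linarith)
  rw [cosPoly] at e1 e2 e3
  have f1 : c 1 + c 2 * (cos t₁ + cos t₂) = 0 := by
    apply mul_left_cancel₀ (sub_ne_zero.2 l1.ne'); linear_combination e1 - e2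
  have f2 : c 1 + c 2 * (cos t₂ + cos t₃) = 0 := by
    apply mul_left_cancel₀ (sub_ne_zero.2 l2.ne'); linear_combination e2 - e3
  have g2 : c 2 = 0 := by
    apply mul_left_cancel₀ (sub_ne_zero.2 (l2.trans l1).ne'); linear_combination f1 - f2
  have g1 : c 1 = 0 := by rw [g2] at f1; linarith
  have g0 : c 0 = 0 := by rw [g1, g2] at e1; linarith
  exact hc (by ext i; fin_cases i <;> assumption)

/-- The integral is a continuous quadratic form in `c`, positive away from zero. Its minimum on the
unit sphere of the three-dimensional coefficient space is the constant, and homogeneity does the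
rest. -/
lemma exists_coercive {a b : ℝ} (ha : 0 < a) (hab : a < b) (hb : b < π) :
    ∃ δ > 0, ∀ c : Fin 3 → ℝ,
      δ * ‖c‖ ^ 2 ≤ ∫ t in a..b, cosPoly c t ^ 2 * ((t - a) * (b - t)) := by
  set S : (Fin 3 → ℝ) → ℝ := fun c => ∫ t in a..b, cosPoly c t ^ 2 * ((t - a) * (b - t))
  have hS : Continuous S := by
    apply intervalIntegral.continuous_parametric_intervalIntegral_of_continuous'
    simp only [Function.uncurry_def, cosPoly]
    fun_prop
  have hpos : ∀ c, c ≠ 0 → 0 < S c := by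
    intro c hc
    obtain ⟨t, ht, hne⟩ := exists_cosPoly_ne_zero hc ha hab hb
    refine intervalIntegral.integral_pos hab ?_ ?_ ⟨t, Ioo_subset_Icc_self ht, ?_⟩
    · simp only [cosPoly]; fun_prop
    · intro s hs
      have h1 : 0 ≤ s - a := by linarith [hs.1]
      have h2 : 0 ≤ b - s := by linarith [hs.2]
      positivity
    · have h1 : 0 < t - a := by linarith [ht.1]
      have h2 : 0 < b - t := by linarith [ht.2]
      positivity
  obtain ⟨c₀, hc₀, hmin⟩ := (isCompact_sphere (0 : Fin 3 → ℝ) 1).exists_isMinOn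
    (NormedSpace.sphere_nonempty.2 zero_le_one) hS.continuousOn
  refine ⟨S c₀, hpos c₀ (by rintro rfl; simp at hc₀), fun c => ?_⟩
  rcases eq_or_ne c 0 with rfl | hc
  · simp [cosPoly]
  have hn : 0 < ‖c‖ := norm_pos_iff.2 hc
  have h1 : S c₀ ≤ S (‖c‖⁻¹ • c) := hmin (by simp [norm_smul, hn.ne'])
  have h2 : S (‖c‖⁻¹ • c) = (‖c‖⁻¹) ^ 2 * S c := by
    simp only [S, ← intervalIntegral.integral_const_mul]
    refine intervalIntegral.integral_congr fun t _ => ?_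
    simp only [cosPoly, Pi.smul_apply, smul_eq_mul]; ring
  rw [h2] at h1
  calc S c₀ * ‖c‖ ^ 2 ≤ (‖c‖⁻¹) ^ 2 * S c * ‖c‖ ^ 2 := by gcongr
    _ = S c := by field_simp

namespace IsRiccati

variable {c : Fin 3 → ℝ} {v : ℝ → ℝ}

lemma continuousOn (h : IsRiccati c v) : ContinuousOn v (Ioo 0 π) := fun θ hθ =>
  (h θ hθ).continuousAt.continuousWithinAt

lemma continuousOn_rhs (h : IsRiccati c v) :
    ContinuousOn (fun θ => cos θ / sin θ * v θ + v θ ^ 2 / 2 - source c θ) (Ioo 0 π) :=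
  ((contDiffOn_cot.continuousOn.mul h.continuousOn).add ((h.continuousOn.pow 2).div_const 2)).sub
    (contDiffOn_source c).continuousOn

lemma integrable_sq (h : IsRiccati c v) {a b : ℝ} (ha : a ∈ Ioo 0 π) (hb : b ∈ Ioo 0 π) :
    IntervalIntegrable (fun t => v t ^ 2) volume a b :=
  intervalIntegrable_of_continuousOn_Ioo (h.continuousOn.pow 2) ha hb

/-- The integrand is `(v η)'`, and `η` vanishes at both ends. No boundary value of `v` appears, so
integral bounds suffice later. -/
lemma weak_form (h : IsRiccati c v) {a b : ℝ} (ha : a ∈ Ioo 0 π) (hb : b ∈ Ioo 0 π)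
    {η η' : ℝ → ℝ} (hη : ∀ t, HasDerivAt η (η' t) t) (hη' : Continuous η') (h0 : η a = 0)
    (h1 : η b = 0) :
    IntervalIntegrable (fun t => (cos t / sin t * v t + v t ^ 2 / 2 - source c t) * η t
      + v t * η' t) volume a b ∧
    ∫ t in a..b, ((cos t / sin t * v t + v t ^ 2 / 2 - source c t) * η t + v t * η' t) = 0 := by
  have hηc : Continuous η := continuous_iff_continuousAt.2 fun t => (hη t).continuousAt
  have hint : IntervalIntegrable (fun t =>
      (cos t / sin t * v t + v t ^ 2 / 2 - source c t) * η t + v t * η' t) volume a b :=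
    intervalIntegrable_of_continuousOn_Ioo ((h.continuousOn_rhs.mul hηc.continuousOn).add
      (h.continuousOn.mul hη'.continuousOn)) ha hb
  refine ⟨hint, ?_⟩
  rw [intervalIntegral.integral_eq_sub_of_hasDerivAt (f := fun t => v t * η t)
    (fun t ht => (h t (ordConnected_Ioo.uIcc_subset ha hb ht)).mul (hη t)) hint]
  simp [h0, h1]

end IsRiccati

/-- The test function is chosen so that the source term becomes the coercive form: `δ ‖c‖²` is then
bounded by the remaining terms, which are linear in the size of the test function, hence at most a
multiple of `‖c‖ (1 + ∫ v²)`. Dividing by `‖c‖` concludes. -/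
lemma exists_coefficient_bound {a b : ℝ} (ha : 0 < a) (hab : a < b) (hb : b < π) :
    ∃ K > 0, ∀ (c : Fin 3 → ℝ) (v : ℝ → ℝ), IsRiccati c v →
      ‖c‖ ≤ K * (1 + ∫ t in a..b, v t ^ 2) := by
  obtain ⟨δ, hδ, hcoer⟩ := exists_coercive ha hab hb
  refine ⟨4000 / δ, by positivity, fun c v h => ?_⟩
  have hb4 : b < 4 := hb.trans_le pi_le_four
  have ha' : a ∈ Ioo 0 π := ⟨ha, hab.trans hb⟩
  have hb' : b ∈ Ioo 0 π := ⟨ha.trans hab, hb⟩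
  -- The factor `sin²` cancels the denominator of the source, and `(t - a) (b - t)` removes the
  -- boundary terms.
  have hη : ∀ t, HasDerivAt (fun t => (t - a) * (b - t) * sin t ^ 2 * cosPoly c t)
      (((b - t - (t - a)) * sin t ^ 2 + (t - a) * (b - t) * (2 * sin t * cos t)) * cosPoly c t
        + (t - a) * (b - t) * sin t ^ 2 * (-sin t * (c 1 + 2 * c 2 * cos t))) t := by
    intro t
    refine (((((hasDerivAt_id t).sub_const a).mul ((hasDerivAt_id t).const_sub b)).mul
      ((hasDerivAt_sin t).pow 2)).mul ((((hasDerivAt_cos t).const_mul (c 1)).const_add (c 0)).add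
      (((hasDerivAt_cos t).pow 2).const_mul (c 2)))).congr_deriv ?_
    simp [cosPoly]; ring
  obtain ⟨hint, hzero⟩ := h.weak_form ha' hb' hη (by simp only [cosPoly]; fun_prop) (by simp)
    (by simp)
  have hi2 := h.integrable_sq ha' hb'
  have hi1 : IntervalIntegrable (fun t => 450 * ‖c‖ * (1 + 2 * v t ^ 2)) volume a b :=
    (((intervalIntegrable_const (c := (1 : ℝ))).add (hi2.const_mul 2))).const_mul _
  have hi3 : IntervalIntegrable (fun t => cosPoly c t ^ 2 * ((t - a) * (b - t))) volume a b := by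
    apply Continuous.intervalIntegrable; simp only [cosPoly]; fun_prop
  have hmono := intervalIntegral.integral_mono_on hab.le hint (hi1.sub hi3) (fun t ht => by
    have hs := (sin_pos_of_mem (mem_Ioo_of_mem_Icc ha hb ht)).ne'
    have hq := abs_cosPoly_le c t
    set q := cosPoly c t with hqdef
    have hw0 : 0 ≤ (t - a) * (b - t) :=
      mul_nonneg (by linarith [ht.1]) (by linarith [ht.2])
    -- Both factors are at most 4, since `0 < a` and `b < π ≤ 4`.
    have hw1 : (t - a) * (b - t) ≤ 16 := by nlinarith [ht.1, ht.2]
    have hw2 : |b - t - (t - a)| ≤ 4 := abs_le.2 ⟨by linarith [ht.1, ht.2], by linarith [ht.1, ht.2]⟩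
    set w := (t - a) * (b - t)
    set w' := b - t - (t - a)
    have hsl := abs_sin_le_one t
    have hcl := abs_cos_le_one t
    have hq' : |c 1 + 2 * c 2 * cos t| ≤ 3 * ‖c‖ := by
      have h1 := norm_le_pi_norm c 1
      have h2 := norm_le_pi_norm c 2
      rw [Real.norm_eq_abs] at h1 h2
      have e : |2 * c 2 * cos t| ≤ 2 * ‖c‖ := by
        rw [abs_mul, abs_mul, abs_two]
        nlinarith [abs_nonneg (c 2), abs_nonneg (cos t)]
      linarith [abs_add_le (c 1) (2 * c 2 * cos t)]
    set q' := c 1 + 2 * c 2 * cos t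
    have hrw : (cos t / sin t * v t + v t ^ 2 / 2 - source c t) * (w * sin t ^ 2 * q)
        + v t * ((w' * sin t ^ 2 + w * (2 * sin t * cos t)) * q + w * sin t ^ 2 * (-sin t * q'))
        = v t * (3 * (w * (sin t * (cos t * q))) + w' * (sin t * (sin t * q))
          + w * (sin t * (sin t * (-(sin t * q')))))
          + v t ^ 2 / 2 * (w * (sin t * (sin t * q))) - q ^ 2 * w := by
      have : source c t = q / sin t ^ 2 := rfl
      rw [this]; field_simp; ring
    have small : ∀ x y : ℝ, |x| ≤ 1 → |y| ≤ 3 * ‖c‖ → |x * y| ≤ 3 * ‖c‖ := fun x y hx hy => by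
      rw [abs_mul]; nlinarith [abs_nonneg x, abs_nonneg y]
    have hwa : |w| ≤ 16 := by rwa [abs_of_nonneg hw0]
    have big : ∀ k x y : ℝ, |x| ≤ k → |y| ≤ 3 * ‖c‖ → |x * y| ≤ k * (3 * ‖c‖) :=
      fun k x y hx hy => by
        rw [abs_mul]; exact mul_le_mul hx hy (abs_nonneg _) ((abs_nonneg _).trans hx)
    have b1 := big 16 w _ hwa (small _ _ hsl (small _ _ hcl hq))
    have b2 := big 4 w' _ hw2 (small _ _ hsl (small _ _ hsl hq))
    have b3 := big 16 w _ hwa (small _ _ hsl (small _ _ hsl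
      ((abs_neg (sin t * q')).le.trans (small _ _ hsl hq'))))
    have b4 := big 16 w _ hwa (small _ _ hsl (small _ _ hsl hq))
    have hv1 : |v t| ≤ 1 + v t ^ 2 := by
      rw [← sq_abs]; nlinarith [sq_nonneg (|v t| - 1), abs_nonneg (v t)]
    have hc0 := norm_nonneg c
    show (cos t / sin t * v t + v t ^ 2 / 2 - source c t) * (w * sin t ^ 2 * q)
        + v t * ((w' * sin t ^ 2 + w * (2 * sin t * cos t)) * q + w * sin t ^ 2 * (-sin t * q'))
        ≤ 450 * ‖c‖ * (1 + 2 * v t ^ 2) - q ^ 2 * w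
    rw [hrw]
    -- Here `204 = 3 · 48 + 12 + 48`, from the bounds `b1`, `b2`, `b3`.
    have t1 : v t * (3 * (w * (sin t * (cos t * q))) + w' * (sin t * (sin t * q))
          + w * (sin t * (sin t * (-(sin t * q'))))) ≤ (1 + v t ^ 2) * (204 * ‖c‖) := by
      refine (le_abs_self _).trans ?_
      rw [abs_mul]
      refine mul_le_mul hv1 ?_ (abs_nonneg _) (by positivity)
      refine (abs_add_three _ _ _).trans ?_
      rw [abs_mul 3, abs_of_pos (by norm_num : (0 : ℝ) < 3)]
      linarith
    have t2 : v t ^ 2 / 2 * (w * (sin t * (sin t * q))) ≤ v t ^ 2 / 2 * (48 * ‖c‖) :=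
      mul_le_mul_of_nonneg_left ((le_abs_self _).trans (by linarith)) (by positivity)
    nlinarith [mul_nonneg (sq_nonneg (v t)) hc0])
  rw [hzero, intervalIntegral.integral_sub hi1 hi3, intervalIntegral.integral_const_mul,
    intervalIntegral.integral_add (by simp) (hi2.const_mul 2),
    intervalIntegral.integral_const_mul, intervalIntegral.integral_const] at hmono
  have hE : 0 ≤ ∫ t in a..b, v t ^ 2 :=
    intervalIntegral.integral_nonneg hab.le fun t _ => sq_nonneg _
  have hc1 := hcoer c
  rcases (norm_nonneg c).eq_or_lt with h0 | hpos
  · rw [← h0]; positivity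
  · set E := ∫ t in a..b, v t ^ 2
    have h2 : δ * ‖c‖ ^ 2 ≤ ‖c‖ * (4000 * (1 + E)) := by
      simp only [smul_eq_mul, mul_one] at hmono
      nlinarith [mul_nonneg hpos.le hE, mul_pos hpos (sub_pos.2 hb4)]
    have h3 : δ * ‖c‖ ≤ 4000 * (1 + E) := by
      apply le_of_mul_le_mul_left _ hpos; linarith
    rw [div_mul_eq_mul_div, le_div_iff₀ hδ]; linarith

lemma abs_source_le {s t : ℝ} (hs : 0 < s) (hst : s ≤ sin t) (c : Fin 3 → ℝ) :
    |source c t| ≤ 3 / s ^ 2 * ‖c‖ := by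
  have h := abs_cosPoly_le c t
  rw [source, abs_div, abs_of_nonneg (sq_nonneg (sin t)), div_mul_eq_mul_div]
  exact div_le_div₀ (by positivity) h (by positivity) (by gcongr)

lemma abs_cot_le {s t : ℝ} (hs : 0 < s) (hst : s ≤ sin t) : |cos t / sin t| ≤ 1 / s := by
  rw [abs_div, abs_of_pos (hs.trans_le hst)]
  exact div_le_div₀ zero_le_one (abs_cos_le_one t) hs hst

/-- The term `w² x² / 2` is coercive. Half of it absorbs the cross term `w x (k w + 2 w')` by
completing a square, and the source costs at most a multiple of `n`. -/
lemma energy_density_lower_bound {s n w w' k R x : ℝ} (hs : 0 < s) (hn : 0 ≤ n) (hw0 : 0 ≤ w)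
    (hw1 : w ≤ 16) (hw' : |w'| ≤ 4) (hk : |k| ≤ 1 / s) (hR : |R| ≤ 3 / s ^ 2 * n) :
    1 / 4 * (w ^ 2 * x ^ 2) - ((16 / s + 8) ^ 2 + 256 * (3 / s ^ 2)) * (1 + n)
      ≤ (k * x + x ^ 2 / 2 - R) * w ^ 2 + x * (2 * w * w') := by
  have hwa : |w| ≤ 16 := by rwa [abs_of_nonneg hw0]
  have hgb : |k * w + 2 * w'| ≤ 16 / s + 8 := by
    refine (abs_add_le _ _).trans ?_
    rw [abs_mul, abs_mul, abs_two]
    have h1 : |k| * |w| ≤ 1 / s * 16 := mul_le_mul hk hwa (abs_nonneg _) (by positivity)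
    have e : 16 / s = 1 / s * 16 := by ring
    rw [e]; linarith
  have hg2 : (k * w + 2 * w') ^ 2 ≤ (16 / s + 8) ^ 2 := by
    rw [← sq_abs (k * w + 2 * w')]; gcongr
  have hRw : R * w ^ 2 ≤ 256 * (3 / s ^ 2) * n := by
    calc R * w ^ 2 ≤ |R| * w ^ 2 := by gcongr; exact le_abs_self _
      _ ≤ (3 / s ^ 2 * n) * 16 ^ 2 := by gcongr
      _ = _ := by ring
  have h1 : 0 ≤ (16 / s + 8) ^ 2 * n := by positivity
  have h2 : 0 ≤ 256 * (3 / s ^ 2) := by positivity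
  nlinarith [sq_nonneg (w * x / 2 + (k * w + 2 * w'))]

/-- Caccioppoli-type estimate: the equation is tested with the square of a cutoff `w` on a slightly
larger interval. Squaring leaves a factor `w` in the derivative, so the term linear in `v` is
absorbed by the quadratic one. -/
lemma exists_energy_bound {α β : ℝ} (hα : 0 < α) (hαβ : α ≤ β) (hβ : β < π) :
    ∃ K > 0, ∀ (c : Fin 3 → ℝ) (v : ℝ → ℝ), IsRiccati c v →
      ∫ t in α..β, v t ^ 2 ≤ K * (1 + ‖c‖) := by
  set a := α / 2 with ha
  set b := (β + π) / 2 with hb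
  have ha0 : 0 < a := by positivity
  have haα : a < α := by linarith
  have hbβ : β < b := by linarith
  have hbπ : b < π := by linarith
  have hb4 : b < 4 := hbπ.trans_le pi_le_four
  have hab : a < b := by linarith
  have ha' : a ∈ Ioo 0 π := ⟨ha0, by linarith⟩
  have hb' : b ∈ Ioo 0 π := ⟨by linarith, hbπ⟩
  obtain ⟨s, hs, hsin⟩ := exists_sin_lower_bound ha0 hbπ
  -- A lower bound for the squared cutoff on `[α, β]`.
  set m := ((α - a) * (b - β)) ^ 2
  have hm : 0 < m := pow_pos (mul_pos (by linarith) (by linarith)) 2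
  set M := (16 / s + 8) ^ 2 + 256 * (3 / s ^ 2)
  have hM : 0 < M := by positivity
  -- The 16 is 4 from the coefficient `1 / 4` times 4 from `b - a ≤ 4`.
  refine ⟨16 * M / m, by positivity, fun c v h => ?_⟩
  have hη : ∀ t, HasDerivAt (fun t => ((t - a) * (b - t)) ^ 2)
      (2 * ((t - a) * (b - t)) * (b - t - (t - a))) t := by
    intro t
    refine ((((hasDerivAt_id t).sub_const a).mul ((hasDerivAt_id t).const_sub b)).pow
      2).congr_deriv ?_
    simp only [id, Nat.cast_ofNat, Nat.reduceSub, pow_one, Pi.mul_apply]; ring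
  obtain ⟨hint, hzero⟩ := h.weak_form ha' hb' hη (by fun_prop) (by simp) (by simp)
  have hi1 : IntervalIntegrable (fun t => 1 / 4 * (((t - a) * (b - t)) ^ 2 * v t ^ 2)
      - M * (1 + ‖c‖)) volume a b := by
    refine intervalIntegrable_of_continuousOn_Ioo (ContinuousOn.sub (continuousOn_const.mul
      (ContinuousOn.mul ?_ (h.continuousOn.pow 2))) continuousOn_const) ha' hb'
    fun_prop
  have hi2 : IntervalIntegrable (fun t => ((t - a) * (b - t)) ^ 2 * v t ^ 2) volume a b := by
    refine intervalIntegrable_of_continuousOn_Ioo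
      (ContinuousOn.mul ?_ (h.continuousOn.pow 2)) ha' hb'
    fun_prop
  have hc0 := norm_nonneg c
  have hmono := intervalIntegral.integral_mono_on hab.le hi1 hint (fun t ht => by
    have hR := abs_source_le hs (hsin t ht) c
    have hC := abs_cot_le hs (hsin t ht)
    have hw0 : 0 ≤ (t - a) * (b - t) :=
      mul_nonneg (by linarith [ht.1]) (by linarith [ht.2])
    have hw1 : (t - a) * (b - t) ≤ 16 := by nlinarith [ht.1, ht.2]
    have hw2 : |b - t - (t - a)| ≤ 4 := abs_le.2 ⟨by linarith [ht.1, ht.2], by linarith [ht.1, ht.2]⟩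
    exact energy_density_lower_bound hs hc0 hw0 hw1 hw2 hC hR)
  rw [hzero, intervalIntegral.integral_sub (hi2.const_mul _) (by simp),
    intervalIntegral.integral_const_mul, intervalIntegral.integral_const, smul_eq_mul] at hmono
  have hα' : α ∈ Ioo 0 π := ⟨hα, by linarith⟩
  have hβ' : β ∈ Ioo 0 π := ⟨by linarith, hβ⟩
  have hsub : ∫ t in α..β, ((t - a) * (b - t)) ^ 2 * v t ^ 2
      ≤ ∫ t in a..b, ((t - a) * (b - t)) ^ 2 * v t ^ 2 :=
    intervalIntegral.integral_mono_interval haα.le hαβ hbβ.le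
      (Eventually.of_forall fun t => by positivity) hi2
  have hlow : ∫ t in α..β, m * v t ^ 2 ≤ ∫ t in α..β, ((t - a) * (b - t)) ^ 2 * v t ^ 2 := by
    refine intervalIntegral.integral_mono_on hαβ ((h.integrable_sq hα' hβ').const_mul m)
      (hi2.mono_set ?_) fun t ht => ?_
    · rw [uIcc_of_le hαβ, uIcc_of_le hab.le]; exact Icc_subset_Icc haα.le hbβ.le
    · have h1 : (α - a) * (b - β) ≤ (t - a) * (b - t) :=
        mul_le_mul (by linarith [ht.1]) (by linarith [ht.2]) (by linarith) (by linarith [ht.1])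
      have h2 : 0 ≤ (α - a) * (b - β) := mul_nonneg (by linarith) (by linarith)
      exact mul_le_mul_of_nonneg_right (pow_le_pow_left₀ h2 h1 2) (sq_nonneg _)
  rw [intervalIntegral.integral_const_mul] at hlow
  rw [div_mul_eq_mul_div, le_div_iff₀ hm]
  have : (b - a) * (M * (1 + ‖c‖)) ≤ 4 * (M * (1 + ‖c‖)) := by
    gcongr; linarith
  linarith

/-- The Riccati equation gives `|v'| ≤ k (1 + v²)`, so the energy bound controls the total variation
of `v`; at some point `v²` is at most its mean. -/
lemma exists_pointwise_bound {α β : ℝ} (hα : 0 < α) (hαβ : α < β) (hβ : β < π) (M : ℝ) :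
    ∃ B > 0, ∀ (c : Fin 3 → ℝ) (v : ℝ → ℝ), IsRiccati c v → ‖c‖ ≤ M →
      ∀ θ ∈ Icc α β, |v θ| ≤ B := by
  obtain ⟨K, hK, hE⟩ := exists_energy_bound hα hαβ.le hβ
  obtain ⟨s, hs, hsin⟩ := exists_sin_lower_bound hα hβ
  -- The three summands dominate the contributions of the cotangent, quadratic and source terms.
  set k := 1 / s + 1 + 3 / s ^ 2 * |M|
  have hk : 0 < k := by positivity
  set E := K * (1 + |M|)
  have hE0 : 0 < E := by positivity
  refine ⟨(1 + E / (β - α)) + k * ((β - α) + E), ?_, fun c v h hcM θ hθ => ?_⟩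
  · have := sub_pos.2 hαβ; positivity
  have hα' : α ∈ Ioo 0 π := ⟨hα, by linarith⟩
  have hβ' : β ∈ Ioo 0 π := ⟨by linarith, hβ⟩
  have hd := sub_pos.2 hαβ
  have hcM' : ‖c‖ ≤ |M| := hcM.trans (le_abs_self M)
  have hEv : ∫ t in α..β, v t ^ 2 ≤ E := (hE c v h).trans (by simp only [E]; gcongr)
  have hi := h.integrable_sq hα' hβ'
  obtain ⟨t₀, ht₀, hvt₀⟩ : ∃ t₀ ∈ Icc α β, v t₀ ^ 2 ≤ E / (β - α) := by
    by_contra! hcon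
    have hlt : ∫ t in α..β, E / (β - α) < ∫ t in α..β, v t ^ 2 := by
      refine intervalIntegral.integral_lt_integral_of_continuousOn_of_le_of_exists_lt hαβ
        continuousOn_const ((h.continuousOn.pow 2).mono fun t ht => mem_Ioo_of_mem_Icc hα hβ ht)
        (fun t ht => (hcon t ⟨ht.1.le, ht.2⟩).le) ⟨α, ⟨le_rfl, hαβ.le⟩, hcon α ⟨le_rfl, hαβ.le⟩⟩
    rw [intervalIntegral.integral_const, smul_eq_mul, mul_div_cancel₀ _ hd.ne'] at hlt
    linarith
  have hsub : uIcc t₀ θ ⊆ Icc α β := ordConnected_Icc.uIcc_subset ht₀ hθ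
  have hIoo : ∀ t ∈ Icc α β, t ∈ Ioo 0 π := fun t ht => mem_Ioo_of_mem_Icc hα hβ ht
  have hftc := intervalIntegral.integral_eq_sub_of_hasDerivAt
    (fun t ht => h t (hIoo t (hsub ht)))
    (intervalIntegrable_of_continuousOn_Ioo h.continuousOn_rhs (hIoo _ ht₀) (hIoo _ hθ))
  have hg : IntervalIntegrable (fun t => k * (1 + v t ^ 2)) volume α β :=
    ((intervalIntegrable_const (c := (1 : ℝ))).add hi).const_mul k
  have hbound : |v θ - v t₀| ≤ k * ((β - α) + E) := by
    rw [← hftc]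
    have h1 : |∫ t in t₀..θ, (cos t / sin t * v t + v t ^ 2 / 2 - source c t)|
        ≤ |∫ t in t₀..θ, k * (1 + v t ^ 2)| := by
      have hsub2 : uIoc t₀ θ ⊆ Icc α β := uIoc_subset_uIcc.trans hsub
      refine intervalIntegral.norm_integral_le_abs_of_norm_le (f := fun t =>
        cos t / sin t * v t + v t ^ 2 / 2 - source c t) ?_ (hg.mono_set ?_)
      · refine (ae_restrict_iff' measurableSet_uIoc).2 (Eventually.of_forall fun t ht => ?_)
        have hR := abs_source_le hs (hsin t (hsub2 ht)) c
        have hC := abs_cot_le hs (hsin t (hsub2 ht))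
        have hR' : |source c t| ≤ 3 / s ^ 2 * |M| := hR.trans (by gcongr)
        have hv1 : |v t| ≤ 1 + v t ^ 2 := by
          rw [← sq_abs]; nlinarith [sq_nonneg (|v t| - 1), abs_nonneg (v t)]
        have h2 : |cos t / sin t * v t| ≤ 1 / s * (1 + v t ^ 2) := by
          rw [abs_mul]; exact mul_le_mul hC hv1 (abs_nonneg _) (by positivity)
        have h3 : 0 ≤ 3 / s ^ 2 * |M| * v t ^ 2 := by positivity
        rw [Real.norm_eq_abs]
        have h4 := abs_sub (cos t / sin t * v t + v t ^ 2 / 2) (source c t)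
        have h5 := abs_add_le (cos t / sin t * v t) (v t ^ 2 / 2)
        rw [abs_of_nonneg (by positivity : 0 ≤ v t ^ 2 / 2)] at h5
        have h6 : k * (1 + v t ^ 2) = 1 / s * (1 + v t ^ 2) + (1 + v t ^ 2)
          + 3 / s ^ 2 * |M| + 3 / s ^ 2 * |M| * v t ^ 2 := by ring
        rw [h6]
        linarith [sq_nonneg (v t)]
      · rw [uIcc_of_le hαβ.le]; exact hsub
    have h2 : |∫ t in t₀..θ, k * (1 + v t ^ 2)| ≤ |∫ t in α..β, k * (1 + v t ^ 2)| := by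
      refine intervalIntegral.abs_integral_mono_interval ?_
        (Eventually.of_forall fun t => by positivity) hg
      exact uIoc_subset_uIoc_of_uIcc_subset_uIcc (hsub.trans (uIcc_of_le hαβ.le).ge)
    have h3 : 0 ≤ ∫ t in α..β, k * (1 + v t ^ 2) :=
      intervalIntegral.integral_nonneg hαβ.le fun t _ => by positivity
    have h4 : ∫ t in α..β, k * (1 + v t ^ 2) = k * ((β - α) + ∫ t in α..β, v t ^ 2) := by
      rw [intervalIntegral.integral_const_mul, intervalIntegral.integral_add (by simp) hi,
        intervalIntegral.integral_const, smul_eq_mul, mul_one]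
    rw [abs_of_nonneg h3, h4] at h2
    exact h1.trans (h2.trans (by gcongr))
  have h0 : |v t₀| ≤ 1 + E / (β - α) := by
    have : |v t₀| ≤ 1 + v t₀ ^ 2 := by
      rw [← sq_abs]; nlinarith [sq_nonneg (|v t₀| - 1), abs_nonneg (v t₀)]
    linarith
  calc |v θ| = |v t₀ + (v θ - v t₀)| := by ring_nf
    _ ≤ |v t₀| + |v θ - v t₀| := abs_add_le _ _
    _ ≤ _ := add_le_add h0 hbound

/-! ### Compactness of families of solutions of the Riccati equation -/

/-- Gronwall in both directions from `x`; the part left of `x` is handled by reflection. The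
condition `1 ≤ K` only simplifies `δ / K` to `δ`. -/
lemma abs_le_exp_of_abs_deriv_le {f f' : ℝ → ℝ} {α β x K δ : ℝ} (hx : x ∈ Icc α β) (hK : 1 ≤ K)
    (hδ : 0 ≤ δ) (hf : ∀ t ∈ Icc α β, HasDerivAt f (f' t) t)
    (hbound : ∀ t ∈ Icc α β, |f' t| ≤ K * |f t| + δ) :
    ∀ t ∈ Icc α β, |f t| ≤ (|f x| + δ) * exp (K * (β - α)) := by
  have hgron : ∀ y, 0 ≤ y → y ≤ β - α →
      gronwallBound |f x| K δ y ≤ (|f x| + δ) * exp (K * (β - α)) := by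
    intro y hy hyle
    rw [gronwallBound_of_K_ne_0 (by linarith)]
    have h1 : exp (K * y) ≤ exp (K * (β - α)) := exp_le_exp.2 (by gcongr)
    have h2 : δ / K ≤ δ := div_le_self hδ hK
    have h3 : 1 ≤ exp (K * y) := one_le_exp (by positivity)
    have h4 : δ / K * (exp (K * y) - 1) ≤ δ * exp (K * (β - α)) :=
      mul_le_mul h2 (by linarith) (by linarith) hδ
    have h5 := mul_le_mul_of_nonneg_left h1 (abs_nonneg (f x))
    linarith
  intro t ht
  rcases le_total x t with hxt | htx
  · have hsub : Icc x β ⊆ Icc α β := Icc_subset_Icc_left hx.1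
    refine (norm_le_gronwallBound_of_norm_deriv_right_le (f := f) (f' := f') (δ := |f x|) (K := K)
      (ε := δ) (a := x) (b := β)
      (fun s hs => (hf s (hsub hs)).continuousAt.continuousWithinAt)
      (fun s hs => (hf s (hsub (Ico_subset_Icc_self hs))).hasDerivWithinAt) le_rfl
      (fun s hs => hbound s (hsub (Ico_subset_Icc_self hs))) t ⟨hxt, ht.2⟩).trans
      (hgron _ (by linarith) (by linarith [ht.2, hx.1]))
  · have hsub : ∀ s ∈ Icc (-x) (-α), -s ∈ Icc α β := fun s hs =>
      ⟨by linarith [hs.2], by linarith [hs.1, hx.2]⟩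
    have hder : ∀ s ∈ Icc (-x) (-α), HasDerivAt (fun s => f (-s)) (-f' (-s)) s := fun s hs => by
      exact ((hf (-s) (hsub s hs)).comp s (hasDerivAt_neg s)).congr_deriv (by simp)
    have h := norm_le_gronwallBound_of_norm_deriv_right_le (f := fun s => f (-s))
      (f' := fun s => -f' (-s)) (δ := |f x|) (K := K) (ε := δ) (a := -x) (b := -α)
      (fun s hs => (hder s hs).continuousAt.continuousWithinAt)
      (fun s hs => (hder s (Ico_subset_Icc_self hs)).hasDerivWithinAt) (by simp)
      (fun s hs => by
        rw [norm_neg]; exact hbound (-s) (hsub s (Ico_subset_Icc_self hs)))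
      (-t) ⟨by linarith, by linarith [ht.1]⟩
    simp only [neg_neg] at h
    exact h.trans (hgron _ (by linarith) (by linarith [ht.1, hx.2]))

lemma source_sub (c c' : Fin 3 → ℝ) (t : ℝ) : source c t - source c' t = source (c - c') t := by
  simp only [source, Pi.sub_apply]; ring

/-- The right-hand side is Lipschitz in `v` for bounded values, by factoring `x² - y²`, and the
source is linear in `c`. -/
lemma abs_rhs_sub_le {s t B x y : ℝ} (hs : 0 < s) (hst : s ≤ sin t) (hx : |x| ≤ B) (hy : |y| ≤ B)
    (c c' : Fin 3 → ℝ) :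
    |(cos t / sin t * x + x ^ 2 / 2 - source c t) - (cos t / sin t * y + y ^ 2 / 2 - source c' t)|
      ≤ (1 / s + B) * |x - y| + 3 / s ^ 2 * ‖c - c'‖ := by
  have e : (cos t / sin t * x + x ^ 2 / 2 - source c t)
      - (cos t / sin t * y + y ^ 2 / 2 - source c' t)
      = (cos t / sin t + (x + y) / 2) * (x - y) - source (c - c') t := by
    rw [← source_sub]; ring
  rw [e]
  refine (abs_sub _ _).trans (add_le_add ?_ (abs_source_le hs hst _))
  rw [abs_mul]
  refine mul_le_mul_of_nonneg_right ((abs_add_le _ _).trans (add_le_add (abs_cot_le hs hst) ?_))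
    (abs_nonneg _)
  rw [abs_div, abs_two]
  linarith [abs_add_le x y]

/-- Uniform convergence to zero on compact subintervals of `(0, π)`. -/
def LocallyNull (d : ℕ → ℝ → ℝ) : Prop :=
  ∀ α β : ℝ, 0 < α → β < π → ∀ ε > 0, ∀ᶠ k in atTop, ∀ t ∈ Icc α β, |d k t| ≤ ε

/-- A solution is determined stably by its coefficients and its value at `π / 2`. These form a
bounded sequence in a finite-dimensional space, so convergence of a subsequence of the data
suffices. -/
lemma exists_subseq_riccati {c : ℕ → Fin 3 → ℝ} {v : ℕ → ℝ → ℝ} (h : ∀ k, IsRiccati (c k) (v k))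
    {M : ℝ} (hM : ∀ k, ‖c k‖ ≤ M) :
    ∃ (c' : Fin 3 → ℝ) (v' : ℝ → ℝ) (n : ℕ → ℕ), StrictMono n ∧ IsRiccati c' v' ∧
      Tendsto (fun k => c (n k)) atTop (𝓝 c') ∧ LocallyNull fun k t => v (n k) t - v' t := by
  have hπ := pi_pos
  obtain ⟨B₀, hB₀, hv₀⟩ := exists_pointwise_bound (α := π / 4) (β := 3 * π / 4) (by positivity)
    (by linarith) (by linarith) M
  obtain ⟨⟨c', y⟩, -, n, hn, hlim⟩ := tendsto_subseq_of_bounded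
    (x := fun k => (c k, v k (π / 2)))
    (s := Metric.closedBall 0 M ×ˢ Metric.closedBall 0 B₀)
    (Metric.isBounded_closedBall.prod Metric.isBounded_closedBall) (fun k => by
      refine ⟨by simpa using hM k, ?_⟩
      simpa using hv₀ _ _ (h k) (hM k) (π / 2) ⟨by linarith, by linarith⟩)
  have hc : Tendsto (fun k => c (n k)) atTop (𝓝 c') := (continuous_fst.tendsto _).comp hlim
  have hy : Tendsto (fun k => v (n k) (π / 2)) atTop (𝓝 y) := (continuous_snd.tendsto _).comp hlim
  have hcauchy : ∀ α β : ℝ, 0 < α → β < π → π / 2 ∈ Icc α β →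
      UniformCauchySeqOn (fun k => v (n k)) atTop (Icc α β) := by
    intro α β hα hβ hmem
    -- The interval is enlarged because `α = β = π / 2` is allowed here, while the pointwise bound
    -- needs a nondegenerate interval.
    obtain ⟨B, hB, hvB⟩ := exists_pointwise_bound (α := α / 2) (β := (β + π) / 2) (by positivity)
      (by linarith [hmem.1, hmem.2]) (by linarith) M
    obtain ⟨s, hs, hsin⟩ := exists_sin_lower_bound hα hβ
    set K := 1 / s + B + 1
    set L := 3 / s ^ 2
    have hL : 0 < L := by positivity
    rw [Metric.uniformCauchySeqOn_iff]
    intro ε hε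
    -- Chosen so that the Gronwall bound, with initial and source errors at most `ε'` and `L ε'`,
    -- equals `ε / 2`.
    set ε' := ε / (2 * (1 + L) * exp (K * (β - α))) with hε'
    have hε'0 : 0 < ε' := by positivity
    obtain ⟨N₁, hN₁⟩ := Metric.cauchySeq_iff.1 hc.cauchySeq ε' hε'0
    obtain ⟨N₂, hN₂⟩ := Metric.cauchySeq_iff.1 hy.cauchySeq ε' hε'0
    refine ⟨max N₁ N₂, fun k hk l hl t ht => ?_⟩
    have h1 := hN₁ k (le_of_max_le_left hk) l (le_of_max_le_left hl)
    have h2 := hN₂ k (le_of_max_le_right hk) l (le_of_max_le_right hl)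
    rw [dist_eq_norm] at h1
    rw [Real.dist_eq] at h2 ⊢
    have hmemB : ∀ t ∈ Icc α β, t ∈ Icc (α / 2) ((β + π) / 2) := fun t ht =>
      ⟨by linarith [ht.1], by linarith [ht.2]⟩
    have key := abs_le_exp_of_abs_deriv_le (f := fun t => v (n k) t - v (n l) t)
      (δ := L * ‖c (n k) - c (n l)‖) (K := K) hmem
      (by have : 0 < 1 / s := by positivity
          simp only [K]; linarith) (by positivity)
      (fun t ht => (h (n k) t (mem_Ioo_of_mem_Icc hα hβ ht)).sub
        (h (n l) t (mem_Ioo_of_mem_Icc hα hβ ht)))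
      (fun t ht => (abs_rhs_sub_le hs (hsin t ht)
        (hvB _ _ (h (n k)) (hM _) t (hmemB t ht))
        (hvB _ _ (h (n l)) (hM _) t (hmemB t ht)) _ _).trans (by
          have := abs_nonneg (v (n k) t - v (n l) t)
          simp only [K, L]; linarith)) t ht
    refine key.trans_lt ?_
    have h3 : |v (n k) (π / 2) - v (n l) (π / 2)| + L * ‖c (n k) - c (n l)‖ ≤ (1 + L) * ε' := by
      have := mul_le_mul_of_nonneg_left h1.le hL.le
      linarith
    calc _ ≤ (1 + L) * ε' * exp (K * (β - α)) := by gcongr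
      _ = ε / 2 := by rw [hε']; field_simp
      _ < ε := by linarith
  -- Enlarging an interval to contain `π / 2` makes the Gronwall estimate available; the strict
  -- margins put the original points in the interior.
  have hbig : ∀ α β : ℝ, 0 < α → β < π → ∃ α' β', 0 < α' ∧ β' < π ∧ α' < α ∧ β < β' ∧
      π / 2 ∈ Icc α' β' := by
    intro α β hα hβ
    refine ⟨min (α / 2) (π / 4), max ((β + π) / 2) (3 * π / 4), lt_min (by linarith) (by linarith),
      max_lt (by linarith) (by linarith), (min_le_left _ _).trans_lt (by linarith),
      lt_of_lt_of_le (by linarith) (le_max_left _ _), (min_le_right _ _).trans (by linarith),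
      le_trans (by linarith) (le_max_right _ _)⟩
  have hex : ∀ t, ∃ z, t ∈ Ioo 0 π → Tendsto (fun k => v (n k) t) atTop (𝓝 z) := by
    intro t
    by_cases ht : t ∈ Ioo 0 π
    · obtain ⟨α, β, hα, hβ, h1, h2, hmem⟩ := hbig t t ht.1 ht.2
      obtain ⟨z, hz⟩ := cauchySeq_tendsto_of_complete
        ((hcauchy α β hα hβ hmem).cauchySeq (x := t) ⟨h1.le, h2.le⟩)
      exact ⟨z, fun _ => hz⟩
    · exact ⟨0, fun h => absurd h ht⟩
  choose v' hv' using hex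
  have hunif : ∀ α β : ℝ, 0 < α → β < π → π / 2 ∈ Icc α β →
      TendstoUniformlyOn (fun k => v (n k)) v' atTop (Icc α β) := fun α β hα hβ hmem =>
    (hcauchy α β hα hβ hmem).tendstoUniformlyOn_of_tendsto
      fun t ht => hv' t (mem_Ioo_of_mem_Icc hα hβ ht)
  refine ⟨c', v', n, hn, ?_, hc, ?_⟩
  · intro θ hθ
    obtain ⟨α, β, hα, hβ, h1, h2, hmem⟩ := hbig θ θ hθ.1 hθ.2
    obtain ⟨B, hB, hvB⟩ := exists_pointwise_bound hα (h1.trans h2) hβ M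
    obtain ⟨s, hs, hsin⟩ := exists_sin_lower_bound hα hβ
    have hsub : ∀ t ∈ Ioo α β, t ∈ Icc α β := fun t ht => Ioo_subset_Icc_self ht
    have hvB' : ∀ t ∈ Icc α β, |v' t| ≤ B := fun t ht =>
      le_of_tendsto ((hv' t (mem_Ioo_of_mem_Icc hα hβ ht)).abs)
        (Eventually.of_forall fun k => hvB _ _ (h (n k)) (hM _) t ht)
    -- The derivatives are given by the equation, so the Lipschitz bound makes them converge
    -- uniformly and the limit may be differentiated.
    refine hasDerivAt_of_tendstoUniformlyOn (s := Ioo α β) isOpen_Ioo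
      (f' := fun k t => cos t / sin t * v (n k) t + v (n k) t ^ 2 / 2 - source (c (n k)) t)
      (f := fun k => v (n k)) (l := atTop)
      (g' := fun t => cos t / sin t * v' t + v' t ^ 2 / 2 - source c' t) ?_
      (Eventually.of_forall fun k t ht => h (n k) t (mem_Ioo_of_mem_Icc hα hβ (hsub t ht)))
      (fun t ht => hv' t (mem_Ioo_of_mem_Icc hα hβ (hsub t ht))) ⟨h1, h2⟩
    rw [Metric.tendstoUniformlyOn_iff]
    intro ε hε
    set A := 1 / s + B
    have hA : 0 < A := by positivity
    set L := 3 / s ^ 2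
    have hL : 0 < L := by positivity
    filter_upwards [Metric.tendstoUniformlyOn_iff.1 (hunif α β hα hβ hmem) (ε / (2 * A))
      (by positivity), Metric.tendsto_nhds.1 hc (ε / (4 * L)) (by positivity)] with k hk1 hk2 t ht
    have e1 := hk1 t (hsub t ht)
    rw [Real.dist_eq] at e1 ⊢
    rw [dist_comm, dist_eq_norm] at hk2
    refine (abs_rhs_sub_le hs (hsin t (hsub t ht)) (hvB' t (hsub t ht))
      (hvB _ _ (h (n k)) (hM _) t (hsub t ht)) _ _).trans_lt ?_
    have e2 : A * |v' t - v (n k) t| ≤ A * (ε / (2 * A)) := by gcongr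
    have e3 : L * ‖c' - c (n k)‖ ≤ L * (ε / (4 * L)) := by gcongr
    have e4 : A * (ε / (2 * A)) = ε / 2 := by field_simp
    have e5 : L * (ε / (4 * L)) = ε / 4 := by field_simp
    simp only [A, L] at *
    linarith
  · intro α₀ β₀ hα₀ hβ₀ ε hε
    obtain ⟨α, β, hα, hβ, h1, h2, hmem⟩ := hbig α₀ β₀ hα₀ hβ₀
    filter_upwards [Metric.tendstoUniformlyOn_iff.1 (hunif α β hα hβ hmem) ε hε] with k hk t ht
    have := hk t ⟨by linarith [ht.1], by linarith [ht.2]⟩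
    rw [dist_comm, Real.dist_eq] at this
    exact this.le

/-! ### Convergence to zero with all derivatives -/

/-- Uniform convergence to zero on compact subintervals of `(0, π)`, together with the derivatives
of order at most `m`. -/
def LocallyNullUpTo : ℕ → (ℕ → ℝ → ℝ) → Prop
  | 0, d => LocallyNull d
  | m + 1, d => LocallyNull d ∧ LocallyNullUpTo m fun k => deriv (d k)

/-- All members of the sequence are smooth on `(0, π)`. -/
def SmoothSeq (d : ℕ → ℝ → ℝ) : Prop := ∀ k, ContDiffOn ℝ ∞ (d k) (Ioo 0 π)

lemma SmoothSeq.deriv {d : ℕ → ℝ → ℝ} (h : SmoothSeq d) : SmoothSeq fun k => deriv (d k) :=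
  fun k => contDiffOn_deriv isOpen_Ioo (h k)

lemma LocallyNull.congr {d e : ℕ → ℝ → ℝ} (h : LocallyNull d) (he : ∀ k, EqOn (e k) (d k) (Ioo 0 π)) :
    LocallyNull e := fun α β hα hβ ε hε => by
  filter_upwards [h α β hα hβ ε hε] with k hk t ht
  rw [he k (mem_Ioo_of_mem_Icc hα hβ ht)]; exact hk t ht

lemma LocallyNull.add {d e : ℕ → ℝ → ℝ} (hd : LocallyNull d) (he : LocallyNull e) :
    LocallyNull fun k t => d k t + e k t := fun α β hα hβ ε hε => by
  filter_upwards [hd α β hα hβ (ε / 2) (by positivity), he α β hα hβ (ε / 2) (by positivity)]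
    with k h1 h2 t ht
  linarith [abs_add_le (d k t) (e k t), h1 t ht, h2 t ht]

lemma exists_abs_bound {f : ℝ → ℝ} (hf : ContinuousOn f (Ioo 0 π)) {α β : ℝ} (hα : 0 < α)
    (hβ : β < π) : ∃ B > 0, ∀ t ∈ Icc α β, |f t| ≤ B := by
  obtain ⟨B, hB⟩ := isCompact_Icc.exists_bound_of_continuousOn
    (hf.mono fun t ht => mem_Ioo_of_mem_Icc (a := α) (b := β) hα hβ ht)
  exact ⟨|B| + 1, by positivity, fun t ht => (hB t ht).trans (by linarith [le_abs_self B])⟩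

lemma LocallyNull.const_mul {d : ℕ → ℝ → ℝ} (hd : LocallyNull d) {f : ℝ → ℝ}
    (hf : ContinuousOn f (Ioo 0 π)) : LocallyNull fun k t => f t * d k t :=
  fun α β hα hβ ε hε => by
  obtain ⟨B, hB, hfB⟩ := exists_abs_bound hf hα hβ
  filter_upwards [hd α β hα hβ (ε / B) (by positivity)] with k h1 t ht
  rw [abs_mul]
  calc |f t| * |d k t| ≤ B * (ε / B) := by
        gcongr
        exacts [hfB t ht, h1 t ht]
    _ = ε := by field_simp

lemma LocallyNull.mul {d e : ℕ → ℝ → ℝ} (hd : LocallyNull d) (he : LocallyNull e) :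
    LocallyNull fun k t => d k t * e k t := fun α β hα hβ ε hε => by
  filter_upwards [hd α β hα hβ ε hε, he α β hα hβ 1 one_pos] with k h1 h2 t ht
  rw [abs_mul]
  calc |d k t| * |e k t| ≤ ε * 1 := by
        gcongr
        exacts [h1 t ht, h2 t ht]
    _ = ε := mul_one ε

lemma locallyNull_scalar_mul {a : ℕ → ℝ} (ha : Tendsto a atTop (𝓝 0)) {f : ℝ → ℝ}
    (hf : ContinuousOn f (Ioo 0 π)) : LocallyNull fun k t => a k * f t := by
  have h : LocallyNull fun k _ => a k := fun α β _ _ ε hε => by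
    filter_upwards [Metric.tendsto_nhds.1 ha ε hε] with k hk t _
    rw [Real.dist_eq, sub_zero] at hk
    exact hk.le
  refine (h.const_mul hf).congr fun k t _ => mul_comm _ _

namespace LocallyNullUpTo

lemma of_succ : ∀ {m : ℕ} {d : ℕ → ℝ → ℝ}, LocallyNullUpTo (m + 1) d → LocallyNullUpTo m d
  | 0, _, h => h.1
  | _ + 1, _, h => ⟨h.1, of_succ h.2⟩

lemma congr : ∀ {m : ℕ} {d e : ℕ → ℝ → ℝ}, LocallyNullUpTo m d →
    (∀ k, EqOn (e k) (d k) (Ioo 0 π)) → LocallyNullUpTo m e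
  | 0, _, _, h, he => LocallyNull.congr h he
  | _ + 1, _, _, h, he => ⟨h.1.congr he, congr h.2 fun k => (he k).deriv isOpen_Ioo⟩

lemma add : ∀ {m : ℕ} {d e : ℕ → ℝ → ℝ}, SmoothSeq d → SmoothSeq e → LocallyNullUpTo m d →
    LocallyNullUpTo m e → LocallyNullUpTo m fun k t => d k t + e k t
  | 0, _, _, _, _, hd, he => LocallyNull.add hd he
  | _ + 1, _, _, sd, se, hd, he => ⟨hd.1.add he.1, (add sd.deriv se.deriv hd.2 he.2).congr
      fun k _ ht => ((hasDerivAt_of_smooth isOpen_Ioo (sd k) ht).add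
        (hasDerivAt_of_smooth isOpen_Ioo (se k) ht)).deriv⟩

lemma const_mul : ∀ {m : ℕ} {d : ℕ → ℝ → ℝ} {f : ℝ → ℝ}, ContDiffOn ℝ ∞ f (Ioo 0 π) →
    SmoothSeq d → LocallyNullUpTo m d → LocallyNullUpTo m fun k t => f t * d k t
  | 0, _, _, hf, _, hd => LocallyNull.const_mul hd hf.continuousOn
  | m + 1, d, f, hf, sd, hd => by
    have hf' := contDiffOn_deriv isOpen_Ioo hf
    refine ⟨hd.1.const_mul hf.continuousOn, ?_⟩
    refine (add (fun k => hf'.mul (sd k)) (fun k => hf.mul (sd.deriv k))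
      (const_mul hf' sd hd.of_succ) (const_mul hf sd.deriv hd.2)).congr fun k _ ht =>
      ((hasDerivAt_of_smooth isOpen_Ioo hf ht).mul
        (hasDerivAt_of_smooth isOpen_Ioo (sd k) ht)).deriv

lemma mul : ∀ {m : ℕ} {d e : ℕ → ℝ → ℝ}, SmoothSeq d → SmoothSeq e → LocallyNullUpTo m d →
    LocallyNullUpTo m e → LocallyNullUpTo m fun k t => d k t * e k t
  | 0, _, _, _, _, hd, he => LocallyNull.mul hd he
  | m + 1, d, e, sd, se, hd, he => by
    refine ⟨hd.1.mul he.1, ?_⟩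
    refine (add (fun k => (sd.deriv k).mul (se k)) (fun k => (sd k).mul (se.deriv k))
      (mul sd.deriv se hd.2 he.of_succ) (mul sd se.deriv hd.of_succ he.2)).congr fun k _ ht =>
      ((hasDerivAt_of_smooth isOpen_Ioo (sd k) ht).mul
        (hasDerivAt_of_smooth isOpen_Ioo (se k) ht)).deriv

lemma scalar_mul : ∀ {m : ℕ} {a : ℕ → ℝ} {f : ℝ → ℝ}, Tendsto a atTop (𝓝 0) →
    ContDiffOn ℝ ∞ f (Ioo 0 π) → LocallyNullUpTo m fun k t => a k * f t
  | 0, _, _, ha, hf => locallyNull_scalar_mul ha hf.continuousOn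
  | _ + 1, a, _, ha, hf => ⟨locallyNull_scalar_mul ha hf.continuousOn,
      (scalar_mul ha (contDiffOn_deriv isOpen_Ioo hf)).congr fun k _ ht =>
        ((hasDerivAt_of_smooth isOpen_Ioo hf ht).const_mul (a k)).deriv⟩

lemma iteratedDeriv : ∀ {m : ℕ} {d : ℕ → ℝ → ℝ}, LocallyNullUpTo m d →
    LocallyNull fun k => iteratedDeriv m (d k)
  | 0, d, h => by simp only [iteratedDeriv_zero]; exact h
  | m + 1, d, h => by simpa only [iteratedDeriv_succ'] using iteratedDeriv h.2

end LocallyNullUpTo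

/-! ### Differences of Riccati solutions and of their profiles -/

section Differences

variable {c : ℕ → Fin 3 → ℝ} {v : ℕ → ℝ → ℝ} {c' : Fin 3 → ℝ} {v' : ℝ → ℝ}

/-- By linearity in `c` the difference is a sum of three fixed smooth functions with coefficients
tending to zero. -/
lemma locallyNullUpTo_source_sub (hc : Tendsto c atTop (𝓝 c')) (m : ℕ) :
    LocallyNullUpTo m fun k t => source (c k) t - source c' t := by
  have hs : ∀ i : Fin 3, ContDiffOn ℝ ∞ (source (Pi.single i 1)) (Ioo 0 π) := fun i =>
    contDiffOn_source _
  have ha : ∀ i : Fin 3, Tendsto (fun k => c k i - c' i) atTop (𝓝 0) := fun i => by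
    simpa using ((tendsto_pi_nhds.1 hc i).sub_const (c' i))
  have h : ∀ i : Fin 3, LocallyNullUpTo m fun k t => (c k i - c' i) * source (Pi.single i 1) t :=
    fun i => LocallyNullUpTo.scalar_mul (ha i) (hs i)
  have s : ∀ i : Fin 3, SmoothSeq fun k t => (c k i - c' i) * source (Pi.single i 1) t :=
    fun i k => contDiffOn_const.mul (hs i)
  refine (((h 0).add (s 0) (s 1) (h 1)).add (fun k => (s 0 k).add (s 1 k)) (s 2) (h 2)).congr
    fun k t _ => ?_
  simp [source]; ring

variable (h : ∀ k, IsRiccati (c k) (v k)) (h' : IsRiccati c' v') (hc : Tendsto c atTop (𝓝 c'))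
  (hv : LocallyNull fun k t => v k t - v' t)

include h h'

lemma smoothSeq_sub : SmoothSeq fun k t => v k t - v' t := fun k =>
  (h k).contDiffOn.sub h'.contDiffOn

/-- With `d = v - v'`, the difference is `v' d + d² / 2`. -/
lemma locallyNullUpTo_sq_sub {m : ℕ} (hd : LocallyNullUpTo m fun k t => v k t - v' t) :
    LocallyNullUpTo m fun k t => v k t ^ 2 / 2 - v' t ^ 2 / 2 := by
  have s := smoothSeq_sub h h'
  have h2 : ContDiffOn ℝ ∞ (fun _ : ℝ => (1 / 2 : ℝ)) (Ioo 0 π) := contDiffOn_const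
  refine ((hd.const_mul h'.contDiffOn s).add (fun k => h'.contDiffOn.mul (s k))
    (fun k => h2.mul ((s k).mul (s k)))
    ((hd.mul s s hd).const_mul h2 fun k => (s k).mul (s k))).congr fun k t _ => ?_
  simp only; ring

include hc hv

/-- Subtracting the two Riccati equations expresses the derivative of the difference through
quantities already null up to order `m`, which gains one order. -/
lemma locallyNullUpTo_sub (m : ℕ) : LocallyNullUpTo m fun k t => v k t - v' t := by
  induction m with
  | zero => exact hv
  | succ m ih =>
    refine ⟨hv, ?_⟩
    have s := smoothSeq_sub h h'
    have hsq := locallyNullUpTo_sq_sub h h' ih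
    have hsrc := locallyNullUpTo_source_sub hc m
    have s2 : SmoothSeq fun k t => v k t ^ 2 / 2 - v' t ^ 2 / 2 := fun k =>
      (((h k).contDiffOn.pow 2).div_const 2).sub ((h'.contDiffOn.pow 2).div_const 2)
    have s3 : SmoothSeq fun k t => source (c k) t - source c' t := fun k =>
      (contDiffOn_source _).sub (contDiffOn_source _)
    have hneg : ContDiffOn ℝ ∞ (fun _ : ℝ => (-1 : ℝ)) (Ioo 0 π) := contDiffOn_const
    refine (((ih.const_mul contDiffOn_cot s).add (fun k => contDiffOn_cot.mul (s k)) s2 hsq).add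
      (fun k => (contDiffOn_cot.mul (s k)).add (s2 k)) (fun k => hneg.mul (s3 k))
      (hsrc.const_mul hneg s3)).congr fun k t ht => ?_
    refine ((h k t ht).sub (h' t ht)).deriv.trans ?_
    simp only; ring

lemma locallyNullUpTo_radialProfile_sub (m : ℕ) :
    LocallyNullUpTo m fun k t => radialProfile (c k) (v k) t - radialProfile c' v' t := by
  have s := smoothSeq_sub h h'
  have hd := locallyNullUpTo_sub h h' hc hv m
  have hsq := locallyNullUpTo_sq_sub h h' hd
  have hsrc := locallyNullUpTo_source_sub hc m
  have s2 : SmoothSeq fun k t => v k t ^ 2 / 2 - v' t ^ 2 / 2 := fun k =>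
    (((h k).contDiffOn.pow 2).div_const 2).sub ((h'.contDiffOn.pow 2).div_const 2)
  have s3 : SmoothSeq fun k t => source (c k) t - source c' t := fun k =>
    (contDiffOn_source _).sub (contDiffOn_source _)
  have hneg : ContDiffOn ℝ ∞ (fun _ : ℝ => (-1 : ℝ)) (Ioo 0 π) := contDiffOn_const
  have hcot : ContDiffOn ℝ ∞ (fun t => -2 * (cos t / sin t)) (Ioo 0 π) :=
    contDiffOn_const.mul contDiffOn_cot
  refine ((hsrc.add s3 (fun k => hcot.mul (s k)) (hd.const_mul hcot s)).add
    (fun k => (s3 k).add (hcot.mul (s k))) (fun k => hneg.mul (s2 k))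
    (hsq.const_mul hneg s2)).congr fun k t _ => ?_
  simp only [radialProfile]; ring

lemma locallyNullUpTo_pressureProfile_sub (m : ℕ) :
    LocallyNullUpTo m fun k t => pressureProfile (c k) (v k) t - pressureProfile c' v' t := by
  have hd := locallyNullUpTo_sub h h' hc hv m
  have hsq := locallyNullUpTo_sq_sub h h' hd
  have hw := locallyNullUpTo_radialProfile_sub h h' hc hv m
  have s2 : SmoothSeq fun k t => v k t ^ 2 / 2 - v' t ^ 2 / 2 := fun k =>
    (((h k).contDiffOn.pow 2).div_const 2).sub ((h'.contDiffOn.pow 2).div_const 2)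
  have sw : SmoothSeq fun k t => radialProfile (c k) (v k) t - radialProfile c' v' t := fun k =>
    (contDiffOn_radialProfile _ (h k).contDiffOn).sub (contDiffOn_radialProfile _ h'.contDiffOn)
  have hneg : ContDiffOn ℝ ∞ (fun _ : ℝ => (-1 : ℝ)) (Ioo 0 π) := contDiffOn_const
  have ha : Tendsto (fun k => c k 2 - c' 2) atTop (𝓝 0) := by
    simpa using ((tendsto_pi_nhds.1 hc 2).sub_const (c' 2))
  refine ((hw.add sw (fun k => hneg.mul (s2 k)) (hsq.const_mul hneg s2)).add
    (fun k => (sw k).add (hneg.mul (s2 k))) (fun k => contDiffOn_const.mul hneg)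
    (LocallyNullUpTo.scalar_mul ha hneg)).congr fun k t _ => ?_
  simp only [pressureProfile]; ring

end Differences

/-! ### Convergence on the sphere -/

lemma exists_iteratedFDerivWithin_bound {G : Type*} [NormedAddCommGroup G] [NormedSpace ℝ G]
    {Φ : E3 → G} (hΦ : ContDiffOn ℝ ∞ Φ offAxis) {K : Set E3} (hK : IsCompact K)
    (hKs : K ⊆ offAxis) (j : ℕ) :
    ∃ B ≥ 1, ∀ i ≤ j, ∀ x ∈ K, ‖iteratedFDerivWithin ℝ i Φ offAxis x‖ ≤ B := by
  have h : ∀ i : ℕ, ∃ B, ∀ x ∈ K, ‖iteratedFDerivWithin ℝ i Φ offAxis x‖ ≤ B := fun i =>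
    hK.exists_bound_of_continuousOn ((hΦ.continuousOn_iteratedFDerivWithin
      (WithTop.coe_le_coe.2 le_top) isOpen_offAxis.uniqueDiffOn).mono hKs)
  choose B hB using h
  refine ⟨1 + ∑ i ∈ Finset.range (j + 1), |B i|, ?_, fun i hi x hx => ?_⟩
  · have : 0 ≤ ∑ i ∈ Finset.range (j + 1), |B i| := Finset.sum_nonneg fun _ _ => abs_nonneg _
    linarith
  · have h1 := Finset.single_le_sum (f := fun i => |B i|) (fun _ _ => abs_nonneg _)
      (Finset.mem_range.2 (Nat.lt_succ_of_le hi))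
    linarith [hB i x hx, le_abs_self (B i)]

/-- On a compact set the derivatives of `polar` and `Φ` are bounded. The Faà di Bruno and Leibniz
estimates therefore bound each derivative by a fixed multiple of those of `d k` on `[α, β]`. -/
lemma eventually_norm_iteratedFDerivWithin_le {G : Type*} [NormedAddCommGroup G]
    [NormedSpace ℝ G] {d : ℕ → ℝ → ℝ} (sd : SmoothSeq d) (hd : ∀ m, LocallyNullUpTo m d)
    {Φ : E3 → G} (hΦ : ContDiffOn ℝ ∞ Φ offAxis) {K : Set E3} (hK : IsCompact K)
    (hKs : K ⊆ offAxis) {α β : ℝ} (hα : 0 < α) (hβ : β < π)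
    (hpolar : ∀ x ∈ K, polar x ∈ Icc α β) (j : ℕ) {ε : ℝ} (hε : 0 < ε) :
    ∀ᶠ k in atTop, ∀ x ∈ K,
      ‖iteratedFDerivWithin ℝ j (fun x => d k (polar x) • Φ x) offAxis x‖ ≤ ε := by
  obtain ⟨D, hD1, hD⟩ := exists_iteratedFDerivWithin_bound contDiffOn_polar hK hKs j
  obtain ⟨L, hL1, hL⟩ := exists_iteratedFDerivWithin_bound hΦ hK hKs j
  have hD0 : 0 ≤ D := zero_le_one.trans hD1
  have hL0 : 0 ≤ L := zero_le_one.trans hL1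
  set N : ℝ := 1 + ∑ i ∈ Finset.range (j + 1), (j.choose i : ℝ) * (i.factorial * D ^ i) * L
  have hN : 0 < N := by
    have : 0 ≤ ∑ i ∈ Finset.range (j + 1), (j.choose i : ℝ) * (i.factorial * D ^ i) * L :=
      Finset.sum_nonneg fun _ _ => by positivity
    linarith
  have hδ : 0 < ε / N := div_pos hε hN
  have hev : ∀ᶠ k in atTop, ∀ i ∈ Finset.range (j + 1), ∀ t ∈ Icc α β,
      |iteratedDeriv i (d k) t| ≤ ε / N :=
    (Filter.eventually_all_finset _).2 fun i _ => (hd i).iteratedDeriv α β hα hβ _ hδ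
  filter_upwards [hev] with k hk x hx
  have hU := isOpen_offAxis.uniqueDiffOn (𝕜 := ℝ)
  have hjle : ∀ i : ℕ, (i : ℕ∞ω) ≤ (∞ : ℕ∞ω) := fun i => WithTop.coe_le_coe.2 le_top
  have hcomp : ∀ i ≤ j, ‖iteratedFDerivWithin ℝ i (d k ∘ polar) offAxis x‖
      ≤ i.factorial * (ε / N) * D ^ i := by
    intro i hi
    refine norm_iteratedFDerivWithin_comp_le (sd k) contDiffOn_polar (hjle i)
      isOpen_Ioo.uniqueDiffOn hU (fun _ hy => polar_mem hy) (hKs hx) ?_ ?_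
    · intro l hl
      rw [iteratedFDerivWithin_of_isOpen l isOpen_Ioo (polar_mem (hKs hx)),
        norm_iteratedFDeriv_eq_norm_iteratedDeriv]
      exact hk l (Finset.mem_range.2 (by omega)) _ (hpolar x hx)
    · intro l hl1 hl
      -- The composition estimate asks for a bound `D ^ l`; this is why the bounds were arranged to
      -- be at least one.
      exact (hD l (hl.trans hi) x hx).trans (le_self_pow₀ hD1 (by omega))
  refine (norm_iteratedFDerivWithin_smul_le (f := d k ∘ polar) (contDiffOn_comp_polar (sd k)) hΦ hU
    (hKs hx) (hjle j)).trans ?_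
  calc _ ≤ ∑ i ∈ Finset.range (j + 1),
        (j.choose i : ℝ) * (i.factorial * (ε / N) * D ^ i) * L := by
        refine Finset.sum_le_sum fun i hi => ?_
        have hi' : i ≤ j := Nat.lt_succ_iff.1 (Finset.mem_range.1 hi)
        have h1 := hcomp i hi'
        have h2 := hL (j - i) (Nat.sub_le _ _) x hx
        gcongr
    _ = (∑ i ∈ Finset.range (j + 1), (j.choose i : ℝ) * (i.factorial * D ^ i) * L) * (ε / N) := by
        rw [Finset.sum_mul]; exact Finset.sum_congr rfl fun i _ => by ring
    _ ≤ N * (ε / N) := by gcongr; simp only [N]; linarith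
    _ = ε := by field_simp

/-- The closed band of the sphere between the polar angles `ε` and `π - ε`. -/
def closedBand (ε : ℝ) : Set E3 := {x | ‖x‖ = 1 ∧ arccos (x 2) ∈ Icc ε (π - ε)}

lemma isCompact_closedBand (ε : ℝ) : IsCompact (closedBand ε) := by
  refine Metric.isCompact_of_isClosed_isBounded ?_ ?_
  · have h1 : IsClosed {x : E3 | ‖x‖ = 1} := isClosed_eq continuous_norm continuous_const
    have h2 : Continuous fun x : E3 => arccos (x 2) :=
      continuous_arccos.comp (contDiff_coord 2).continuous
    exact h1.inter (isClosed_Icc.preimage h2)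
  · refine Metric.isBounded_closedBall.subset (s := closedBand ε) (t := Metric.closedBall 0 1) ?_
    intro x hx
    simpa using hx.1.le

lemma closedBand_subset_offAxis {ε : ℝ} (hε : 0 < ε) : closedBand ε ⊆ offAxis := by
  intro x hx
  by_contra hcon
  simp only [offAxis, mem_ofPred_eq, not_or, not_not] at hcon
  have h := norm_sq_E3 x
  rw [hx.1, hcon.1, hcon.2] at h
  have h2 : (x 2 - 1) * (x 2 + 1) = 0 := by linear_combination -h
  obtain ⟨h3, h4⟩ := hx.2
  rcases mul_eq_zero.1 h2 with e | e
  · rw [sub_eq_zero.1 e, arccos_one] at h3; linarith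
  · rw [eq_neg_of_add_eq_zero_left e, arccos_neg_one] at h4; linarith

lemma polar_mem_of_mem_closedBand {ε : ℝ} {x : E3} (hx : x ∈ closedBand ε) :
    polar x ∈ Icc ε (π - ε) := by
  rw [polar, hx.1, div_one]; exact hx.2

lemma sphereBand_subset_closedBand (ε : ℝ) : sphereBand ε (π - ε) ⊆ closedBand ε := fun _ hx =>
  ⟨hx.1, Ioo_subset_Icc_self hx.2⟩

lemma HasProfile.radial_eq {u : E3 → E3} {w v : ℝ → ℝ} (h : HasProfile u w v) {x : E3}
    (hx : x ∈ offAxis) : u (‖x‖⁻¹ • x) = w (polar x) • (‖x‖⁻¹ • x) + v (polar x) • fieldTheta x := by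
  obtain ⟨θ, hθ, φ, hx'⟩ := exists_spherical hx
  have hn := norm_pos_of_mem_offAxis hx
  have h1 := h.u_eq 1 one_pos θ hθ φ
  rw [one_smul, inv_one, one_smul] at h1
  rw [hx', polar_smul_eR hn hθ, fieldTheta_smul_eR hn hθ, inv_smul_smul_eR hn, h1]

lemma HasPressureProfile.radial_eq {p : E3 → ℝ} {P : ℝ → ℝ} (h : HasPressureProfile p P) {x : E3}
    (hx : x ∈ offAxis) : p (‖x‖⁻¹ • x) = P (polar x) := by
  obtain ⟨θ, hθ, φ, hx'⟩ := exists_spherical hx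
  have hn := norm_pos_of_mem_offAxis hx
  have h1 := h.p_eq 1 one_pos θ hθ φ
  rw [one_smul, one_pow, inv_one, one_mul] at h1
  rw [hx', polar_smul_eR hn hθ, inv_smul_smul_eR hn, h1]

/-- Constant extension along rays turns the difference into three scalar functions of the polar
angle multiplying fixed fields `Φ₁`, `Φ₂`, `Φ₃`, smooth off the axis. The closed band supplies the
compact set. -/
lemma tendsto_sphereCmNorm_of_profiles {u : ℕ → E3 → E3} {p : ℕ → E3 → ℝ} {w v P : ℕ → ℝ → ℝ}
    {u' : E3 → E3} {p' : E3 → ℝ} {w' v' P' : ℝ → ℝ} (hu : ∀ k, HasProfile (u k) (w k) (v k))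
    (hp : ∀ k, HasPressureProfile (p k) (P k)) (hu' : HasProfile u' w' v')
    (hp' : HasPressureProfile p' P') (hw : ∀ m, LocallyNullUpTo m fun k t => w k t - w' t)
    (hv : ∀ m, LocallyNullUpTo m fun k t => v k t - v' t)
    (hP : ∀ m, LocallyNullUpTo m fun k t => P k t - P' t) {ε : ℝ} (hε : 0 < ε) (m : ℕ) :
    Tendsto (fun k => sphereCmNorm m (sphereBand ε (π - ε))
      (fun x => (u k x - u' x, p k x - p' x))) atTop (𝓝 0) := by
  have sw : SmoothSeq fun k t => w k t - w' t := fun k => (hu k).smooth_w.sub hu'.smooth_w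
  have sv : SmoothSeq fun k t => v k t - v' t := fun k => (hu k).smooth_v.sub hu'.smooth_v
  have sP : SmoothSeq fun k t => P k t - P' t := fun k => (hp k).smooth_P.sub hp'.smooth_P
  set Φ₁ : E3 → E3 × ℝ := fun x => (‖x‖⁻¹ • x, 0)
  set Φ₂ : E3 → E3 × ℝ := fun x => (fieldTheta x, 0)
  set Φ₃ : E3 → E3 × ℝ := fun _ => (0, 1)
  have hΦ₁ : ContDiffOn ℝ ∞ Φ₁ offAxis :=
    (contDiffOn_inv_norm.smul contDiffOn_id).prodMk contDiffOn_const
  have hΦ₂ : ContDiffOn ℝ ∞ Φ₂ offAxis := contDiffOn_fieldTheta.prodMk contDiffOn_const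
  have hΦ₃ : ContDiffOn ℝ ∞ Φ₃ offAxis := contDiffOn_const
  have hK := isCompact_closedBand ε
  have hKs := closedBand_subset_offAxis hε
  have hpol : ∀ x ∈ closedBand ε, polar x ∈ Icc ε (π - ε) := fun x hx =>
    polar_mem_of_mem_closedBand hx
  have hβ : π - ε < π := by linarith
  have key : ∀ δ : ℝ, 0 < δ → ∀ j : ℕ, ∀ᶠ k in atTop, ∀ x ∈ closedBand ε,
      ‖iteratedFDeriv ℝ j (radialExtension fun x => (u k x - u' x, p k x - p' x)) x‖ ≤ δ := by
    intro δ hδ j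
    have hδ3 : 0 < δ / 3 := by positivity
    filter_upwards [eventually_norm_iteratedFDerivWithin_le sw hw hΦ₁ hK hKs hε hβ hpol j hδ3,
      eventually_norm_iteratedFDerivWithin_le sv hv hΦ₂ hK hKs hε hβ hpol j hδ3,
      eventually_norm_iteratedFDerivWithin_le sP hP hΦ₃ hK hKs hε hβ hpol j hδ3]
      with k h1 h2 h3 x hx
    have hxs := hKs hx
    have hjle : (j : ℕ∞ω) ≤ (∞ : ℕ∞ω) := WithTop.coe_le_coe.2 le_top
    have hU := isOpen_offAxis.uniqueDiffOn (𝕜 := ℝ)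
    have heq : EqOn (radialExtension fun x => (u k x - u' x, p k x - p' x))
        (((fun x => (w k (polar x) - w' (polar x)) • Φ₁ x)
          + fun x => (v k (polar x) - v' (polar x)) • Φ₂ x)
          + fun x => (P k (polar x) - P' (polar x)) • Φ₃ x) offAxis := by
      intro y hy
      simp only [radialExtension, (hu k).radial_eq hy, hu'.radial_eq hy, (hp k).radial_eq hy,
        hp'.radial_eq hy, Pi.add_apply, Φ₁, Φ₂, Φ₃, Prod.smul_mk, Prod.mk_add_mk, smul_zero,
        smul_eq_mul, mul_one, mul_zero, add_zero, zero_add]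
      congr 1
      module
    have c1 : ContDiffOn ℝ ∞ (fun x => (w k (polar x) - w' (polar x)) • Φ₁ x) offAxis :=
      (contDiffOn_comp_polar (sw k)).smul hΦ₁
    have c2 : ContDiffOn ℝ ∞ (fun x => (v k (polar x) - v' (polar x)) • Φ₂ x) offAxis :=
      (contDiffOn_comp_polar (sv k)).smul hΦ₂
    have c3 : ContDiffOn ℝ ∞ (fun x => (P k (polar x) - P' (polar x)) • Φ₃ x) offAxis :=
      (contDiffOn_comp_polar (sP k)).smul hΦ₃
    have c12 : ContDiffOn ℝ ∞ ((fun x => (w k (polar x) - w' (polar x)) • Φ₁ x)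
        + fun x => (v k (polar x) - v' (polar x)) • Φ₂ x) offAxis := c1.add c2
    rw [← iteratedFDerivWithin_of_isOpen j isOpen_offAxis hxs,
      iteratedFDerivWithin_congr heq hxs j,
      iteratedFDerivWithin_add_apply ((c12 x hxs).of_le hjle) ((c3 x hxs).of_le hjle) hU hxs,
      iteratedFDerivWithin_add_apply ((c1 x hxs).of_le hjle) ((c2 x hxs).of_le hjle) hU hxs]
    refine (norm_add₃_le).trans ?_
    linarith [h1 x hx, h2 x hx, h3 x hx]
  rw [ENNReal.tendsto_nhds_zero]
  intro δ hδ
  -- The infinite tolerance is separated because its `toReal` is zero.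
  rcases eq_or_ne δ ⊤ with rfl | htop
  · simp
  have hδ' : 0 < δ.toReal := ENNReal.toReal_pos hδ.ne' htop
  have hall : ∀ᶠ k in atTop, ∀ j ∈ Finset.range (m + 1), ∀ x ∈ closedBand ε,
      ‖iteratedFDeriv ℝ j (radialExtension fun x => (u k x - u' x, p k x - p' x)) x‖
        ≤ δ.toReal :=
    (Filter.eventually_all_finset _).2 fun j _ => key _ hδ' j
  filter_upwards [hall] with k hk
  refine iSup₂_le fun j hj => iSup₂_le fun x hx => ?_
  rw [← ofReal_norm, ← ENNReal.ofReal_toReal htop]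
  exact ENNReal.ofReal_le_ofReal
    (hk j (Finset.mem_range.2 (Nat.lt_succ_of_le hj)) x (sphereBand_subset_closedBand ε hx))

/-! ### The main results -/

lemma HasProfile.bandEnergy_le {u : E3 → E3} {c : Fin 3 → ℝ} {v : ℝ → ℝ}
    (h : HasProfile u (radialProfile c v) v) {a b : ℝ} (ha : 0 < a) (hab : a ≤ b) (hb : b < π) :
    bandEnergy u a b ≤ 2 * π * ∫ t in a..b, v t ^ 2 := by
  have hv := h.smooth_v.continuousOn
  have ha' : a ∈ Ioo 0 π := ⟨ha, by linarith⟩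
  have hb' : b ∈ Ioo 0 π := ⟨by linarith, hb⟩
  rw [h.bandEnergy_eq ha hab hb]
  refine mul_le_mul_of_nonneg_left (intervalIntegral.integral_mono_on hab
    (intervalIntegrable_of_continuousOn_Ioo ((hv.pow 2).mul continuous_sin.continuousOn) ha' hb')
    (intervalIntegrable_of_continuousOn_Ioo (hv.pow 2) ha' hb') fun t _ =>
      mul_le_of_le_one_right (sq_nonneg _) (sin_le_one t)) two_pi_pos.le

/-- Away from the poles the surface weight `sin θ` is bounded below, so the band energy and the
plain `L²` norm of the profile are comparable. -/
lemma HasProfile.integral_sq_le {u : E3 → E3} {c : Fin 3 → ℝ} {v : ℝ → ℝ}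
    (h : HasProfile u (radialProfile c v) v) {a b s : ℝ} (ha : 0 < a) (hab : a ≤ b) (hb : b < π)
    (hs : 0 < s) (hsin : ∀ t ∈ Icc a b, s ≤ sin t) :
    ∫ t in a..b, v t ^ 2 ≤ (2 * π * s)⁻¹ * bandEnergy u a b := by
  have hv := h.smooth_v.continuousOn
  have ha' : a ∈ Ioo 0 π := ⟨ha, by linarith⟩
  have hb' : b ∈ Ioo 0 π := ⟨by linarith, hb⟩
  have h1 : ∫ t in a..b, s * v t ^ 2 ≤ ∫ t in a..b, v t ^ 2 * sin t :=
    intervalIntegral.integral_mono_on hab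
      ((intervalIntegrable_of_continuousOn_Ioo (hv.pow 2) ha' hb').const_mul s)
      (intervalIntegrable_of_continuousOn_Ioo ((hv.pow 2).mul continuous_sin.continuousOn) ha' hb')
      fun t ht => by rw [mul_comm]; exact mul_le_mul_of_nonneg_left (hsin t ht) (sq_nonneg _)
  rw [intervalIntegral.integral_const_mul] at h1
  rw [h.bandEnergy_eq ha hab hb]
  have hπ := pi_pos
  have e : (2 * π * s)⁻¹ * (2 * π * ∫ t in a..b, v t ^ 2 * sin t)
      = s⁻¹ * ∫ t in a..b, v t ^ 2 * sin t := by field_simp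
  rw [e, inv_mul_eq_div, le_div_iff₀ hs]
  linarith

lemma exists_bandEnergy_bound {θ₁ θ₂ θ₃ θ₄ : ℝ} (h₁ : 0 < θ₁) (h₁₂ : θ₁ < θ₂) (h₂₃ : θ₂ < θ₃)
    (h₃₄ : θ₃ < θ₄) (h₄ : θ₄ < π) :
    ∃ C > 0, ∀ (ν : ℝ) (u : E3 → E3) (p : E3 → ℝ), 0 < ν → IsSolution ν u p →
      bandEnergy u θ₁ θ₄ ≤ C * (bandEnergy u θ₂ θ₃ + ν ^ 2) := by
  obtain ⟨K₁, hK₁, hcoeff⟩ := exists_coefficient_bound (h₁.trans h₁₂) h₂₃ (h₃₄.trans h₄)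
  obtain ⟨K₂, hK₂, henergy⟩ := exists_energy_bound h₁ (h₁₂.trans (h₂₃.trans h₃₄)).le h₄
  obtain ⟨s, hs, hsin⟩ := exists_sin_lower_bound (h₁.trans h₁₂) (h₃₄.trans h₄)
  have hπ := pi_pos
  refine ⟨2 * π * (K₂ * (1 + K₁ * (1 + (2 * π * s)⁻¹))), by positivity,
    fun ν u p hν h => ?_⟩
  obtain ⟨c, v, hr, hu, -⟩ := (h.rescale hν).exists_riccati
  have e1 := hu.bandEnergy_le h₁ (h₁₂.trans (h₂₃.trans h₃₄)).le h₄
  have e2 := hu.integral_sq_le (h₁.trans h₁₂) h₂₃.le (h₃₄.trans h₄) hs hsin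
  have e3 := hcoeff c v hr
  have e4 := henergy c v hr
  have hE : 0 ≤ bandEnergy (ν⁻¹ • u) θ₂ θ₃ := by
    rw [hu.bandEnergy_eq (h₁.trans h₁₂) h₂₃.le (h₃₄.trans h₄)]
    refine mul_nonneg two_pi_pos.le (intervalIntegral.integral_nonneg h₂₃.le fun t ht => ?_)
    exact mul_nonneg (sq_nonneg _) (hs.le.trans (hsin t ht))
  set E := bandEnergy (ν⁻¹ • u) θ₂ θ₃ with hEdef
  set q := (2 * π * s)⁻¹ with hq
  have hq0 : 0 < q := by positivity
  have e5 : bandEnergy (ν⁻¹ • u) θ₁ θ₄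
      ≤ 2 * π * (K₂ * (1 + K₁ * (1 + q))) * (E + 1) := by
    calc bandEnergy (ν⁻¹ • u) θ₁ θ₄ ≤ 2 * π * (K₂ * (1 + K₁ * (1 + q * E))) := by
          refine e1.trans ?_
          gcongr
          refine e4.trans ?_
          gcongr
          refine e3.trans ?_
          gcongr
      _ ≤ 2 * π * (K₂ * ((1 + K₁ * (1 + q)) * (E + 1))) := by
          gcongr
          have h1 : 0 ≤ K₁ * E := by positivity
          have h2 : 0 ≤ K₁ * q := by positivity
          nlinarith
      _ = _ := by ring
  -- The energy is quadratic in the field, so undoing the rescaling multiplies the estimate by `ν²`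
  -- and turns the constant 1 into `ν²`.
  rw [hEdef, bandEnergy_smul, bandEnergy_smul] at e5
  have e6 := mul_le_mul_of_nonneg_left e5 (sq_nonneg ν)
  have hν2 : ν ^ 2 * (ν⁻¹) ^ 2 = 1 := by field_simp
  calc bandEnergy u θ₁ θ₄ = ν ^ 2 * (ν⁻¹) ^ 2 * bandEnergy u θ₁ θ₄ := by rw [hν2, one_mul]
    _ ≤ 2 * π * (K₂ * (1 + K₁ * (1 + q)))
        * (ν ^ 2 * (ν⁻¹) ^ 2 * bandEnergy u θ₂ θ₃ + ν ^ 2) := by linarith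
    _ = _ := by rw [hν2, one_mul]

lemma exists_subseq_rescaled_solutions {ν : ℕ → ℝ} {u : ℕ → E3 → E3} {p : ℕ → E3 → ℝ}
    (hν : ∀ k, 0 < ν k) (h : ∀ k, IsSolution (ν k) (u k) (p k)) {a b : ℝ} (ha : 0 < a)
    (hab : a < b) (hb : b < π)
    (hbdd : BddAbove (range fun k => (ν k ^ 2)⁻¹ * bandEnergy (u k) a b)) :
    ∃ (u' : E3 → E3) (p' : E3 → ℝ), IsSolution 1 u' p' ∧ ∃ n : ℕ → ℕ, StrictMono n ∧
      ∀ ε : ℝ, 0 < ε → ∀ m : ℕ, Tendsto (fun k => sphereCmNorm m (sphereBand ε (π - ε))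
        (fun x => ((ν (n k))⁻¹ • u (n k) x - u' x, (ν (n k) ^ 2)⁻¹ * p (n k) x - p' x)))
        atTop (𝓝 0) := by
  choose c v hr hu hp using fun k => ((h k).rescale (hν k)).exists_riccati
  obtain ⟨A, hA⟩ := hbdd
  obtain ⟨K, hK, hcoeff⟩ := exists_coefficient_bound ha hab hb
  obtain ⟨s, hs, hsin⟩ := exists_sin_lower_bound ha hb
  have hπ := pi_pos
  -- The hypothesis is exactly a uniform energy bound for the rescaled fields on one band, and that
  -- already bounds all coefficients.
  have hc : ∀ k, ‖c k‖ ≤ K * (1 + (2 * π * s)⁻¹ * A) := by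
    intro k
    refine (hcoeff _ _ (hr k)).trans ?_
    gcongr
    refine ((hu k).integral_sq_le ha hab.le hb hs hsin).trans ?_
    gcongr
    rw [bandEnergy_smul, inv_pow]
    exact hA ⟨k, rfl⟩
  obtain ⟨c', v', n, hn, hr', hlim, hnull⟩ := exists_subseq_riccati hr hc
  have hrn : ∀ k, IsRiccati (c (n k)) (v (n k)) := fun k => hr (n k)
  have hv' := hr'.contDiffOn
  refine ⟨_, _, isSolution_of_riccati hr', n, hn, fun ε hε m => ?_⟩
  exact tendsto_sphereCmNorm_of_profiles (fun k => hu (n k)) (fun k => hp (n k))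
    (hasProfile_profileField (contDiffOn_radialProfile c' hv') hv')
    (hasPressureProfile_profilePressure (contDiffOn_pressureProfile c' hv'))
    (locallyNullUpTo_radialProfile_sub hrn hr' hlim hnull)
    (locallyNullUpTo_sub hrn hr' hlim hnull)
    (locallyNullUpTo_pressureProfile_sub hrn hr' hlim hnull) hε m

end HomNS

end

theorem theorem1p1 :
    (∀ θ₁ θ₂ θ₃ θ₄ : ℝ, 0 < θ₁ → θ₁ < θ₂ → θ₂ < θ₃ → θ₃ < θ₄ → θ₄ < π →
      ∃ C : ℝ, 0 < C ∧
        ∀ (ν : ℝ) (u : HomNS.E3 → HomNS.E3) (p : HomNS.E3 → ℝ),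
          0 < ν → ν < 1 → HomNS.IsSolution ν u p →
            HomNS.bandEnergy u θ₁ θ₄ ≤ C * (HomNS.bandEnergy u θ₂ θ₃ + ν ^ 2)) ∧
    (∀ (ν : ℕ → ℝ) (u : ℕ → HomNS.E3 → HomNS.E3) (p : ℕ → HomNS.E3 → ℝ),
      (∀ k, 0 < ν k) → Tendsto ν atTop (𝓝 0) →
      (∀ k, HomNS.IsSolution (ν k) (u k) (p k)) →
      (∃ a b : ℝ, 0 < a ∧ a < b ∧ b < π ∧
        BddAbove (range fun k => (ν k ^ 2)⁻¹ * HomNS.bandEnergy (u k) a b)) →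
      ∃ (u' : HomNS.E3 → HomNS.E3) (p' : HomNS.E3 → ℝ),
        HomNS.IsSolution 1 u' p' ∧
        ∃ n : ℕ → ℕ, StrictMono n ∧
          ∀ ε : ℝ, 0 < ε → ∀ m : ℕ,
            Tendsto
              (fun k => HomNS.sphereCmNorm m (HomNS.sphereBand ε (π - ε))
                (fun x => ((ν (n k))⁻¹ • u (n k) x - u' x,
                  (ν (n k) ^ 2)⁻¹ * p (n k) x - p' x)))
              atTop (𝓝 0)) := by
  refine ⟨fun θ₁ θ₂ θ₃ θ₄ h₁ h₁₂ h₂₃ h₃₄ h₄ => ?_, fun ν u p hν _ h hbdd => ?_⟩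
  · obtain ⟨C, hC, hbound⟩ := HomNS.exists_bandEnergy_bound h₁ h₁₂ h₂₃ h₃₄ h₄
    exact ⟨C, hC, fun ν u p hν _ h => hbound ν u p hν h⟩
  · obtain ⟨a, b, ha, hab, hb, hbdd⟩ := hbdd
    exact HomNS.exists_subseq_rescaled_solutions hν h ha hab hb hbdd
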